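/- **Notation.** Let $\tilde\Gamma=\mathrm{SL}(2,\mathbb Z)$, acting on $\mathcal H=\mathbb Z a\oplus\mathbb Z b$, where $\mathcal H$ carries the skew-symmetric form with $a\cdot b=1$. Let $\Gamma=\mathrm{PSL}(2,\mathbb Z)=\tilde\Gamma/\{\pm1\}$, and put $$\mathbb X=\begin{pmatrix}-1&1\\-1&0\end{pmatrix},\qquad \mathbb Y=\begin{pmatrix}0&-1\\1&0\end{pmatrix}$$ (the same letters denote the images in $\Gamma$). Let $\mathbb B_3=\langle\sigma_1,\sigma_2\mid\sigma_1\sigma_2\sigma_1=\sigma_2\sigma_1\sigma_2\rangle$, with the epimorphisms $\mathbb B_3\to\tilde\Gamma\to\Gamma$ given by $\sigma_1\mapsto\mathbb X\mathbb Y$, $\sigma_2\mapsto\mathbb X^2\mathbb Y\mathbb X^{-1}$, and with the Artin action on the free group $\langle\alpha_1,\alpha_2,\alpha_3\rangle$ in which $\sigma_i$ sends $\alpha_i\mapsto\alpha_i\alpha_{i+1}\alpha_i^{-1}$, $\alpha_{i+1}\mapsto\alpha_i$ and fixes the remaining generator. For a group $G$, a $G$-valued *braid monodromy factorization* of length $r$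 is a sequence $\bar{\mathfrak m}=(\mathfrak m_1,\dots,\mathfrak m_r)$ of elements of $G$. Two of them are *strongly Hurwitz equivalent* if they are related by a finite sequence of moves $$(\dots,\mathfrak m_i,\mathfrak m_{i+1},\dots)\mapsto(\dots,\mathfrak m_i^{-1}\mathfrak m_{i+1}\mathfrak m_i,\mathfrak m_i,\dots)$$ and their inverses. The *monodromy at infinity* is $\mathfrak m_r\cdots\mathfrak m_1\in G$, and the *monodromy group* is the subgroup $\langle\mathfrak m_1,\dots,\mathfrak m_r\rangle\subset G$. A $\Gamma$-valued (respectively, $\tilde\Gamma$- or $\mathbb B_3$-valued) factorization is *simple* if every $\mathfrak m_i$ is conjugate to $\mathbb X\mathbb Y$ (respectively, to $\mathbb X\mathbb Y$ or $\sigma_1$). Every simple $\Gamma$-valued factorization has a unique simple lift to $\tilde\Gamma$ and a unique simple lift to $\mathbb B_3$. The *transcendental lattice* of a simple $\Gamma$-valued factorization is defined through its simple lift $(\mathfrak m_1,\dots,\mathfrak m_r)$ to $\tilde\Gamma$. Define $\chi:\mathcal H^{\oplus r}\to\mathcal H$ and $q:\mathcal H^{\oplus r}\to\mathbb Z$ by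 $$\chi(x)=\sum_i(\mathfrak m_i-1)x_i,\qquad q(x)=-\sum_i x_i\cdot\mathfrak m_ix_i+\sum_{i<j}(\mathfrak m_i-1)x_i\cdot(\mathfrak m_j-1)x_j .$$ The lattice is the quotient of $\ker\chi$ by $\{x\in\ker\chi\mid q(y+x)=q(y)\text{ for all }y\in\ker\chi\}$, with the quadratic form induced by $q$. The *fundamental group* of a simple $\Gamma$-valued factorization is defined through its simple lift $(\beta_1,\dots,\beta_r)$ to $\mathbb B_3$: it is $$\langle\alpha_1,\alpha_2,\alpha_3\mid\beta_i(\alpha_j)=\alpha_j,\ i=1,\dots,r,\ j=1,2,3\rangle .$$ Finally, let $C(k)=\binom{2k}{k}/(k+1)$ be the $k$-th Catalan number and let $\tilde T(k)=(5k+4)C(k)/(k+2)$, which is an integer. **Theorem.** For each integer $k\ge0$ there are simple $\Gamma$-valued braid monodromy factorizations $\bar{\mathfrak m}_1,\dots,\bar{\mathfrak m}_{\tilde T(k)}$ of length $k+2$ such that: 1. each of them has monodromy at infinity $(\mathbb X\mathbb Y)^{-5k-4}$; 2. their transcendental lattices are pairwise isometric; 3. their fundamental groups are pairwise isomorphic,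 and are isomorphic to $\mathbb Z$ if $k\ge2$; 4. they are pairwise not strongly Hurwitz equivalent; moreover, their monodromy groups are pairwise distinct subgroups of $\Gamma$, each of index $6(k+1)$. -/

import Mathlib

open scoped MatrixGroups

namespace BraidMonodromy

/-! ### Factorizations with values in an arbitrary group -/

section Group

variable {G : Type*} [Group G] {r : ℕ}

/-- A `G`-valued braid monodromy factorization of length `r`. -/
abbrev Factorization (G : Type*) (r : ℕ) : Type _ := Fin r → G

/-- One Hurwitz move
`(…, mᵢ, mᵢ₊₁, …) ↦ (…, mᵢ⁻¹ mᵢ₊₁ mᵢ, mᵢ, …)`, all other entries being unchanged. -/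
def HurwitzMove (m m' : Factorization G r) : Prop :=
  ∃ i j : Fin r, (j : ℕ) = i + 1 ∧
    m' i = (m i)⁻¹ * m j * m i ∧ m' j = m i ∧ ∀ l, l ≠ i → l ≠ j → m' l = m l

/-- Strong Hurwitz equivalence: a finite sequence of Hurwitz moves and their inverses. -/
def StronglyEquivalent (m m' : Factorization G r) : Prop :=
  Relation.EqvGen HurwitzMove m m'

/-- The monodromy at infinity `m_r ⋯ m_2 m_1`. -/
def monodromyAtInfinity (m : Factorization G r) : G :=
  (List.ofFn m).reverse.prod

/-- The monodromy group `⟨m_1, …, m_r⟩`. -/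
def monodromyGroup (m : Factorization G r) : Subgroup G :=
  Subgroup.closure (Set.range m)

end Group

/-! ### The modular group -/

/-- The generator `𝕏`, of order three in `SL(2, ℤ)`. -/
def matX : SL(2, ℤ) := ⟨!![-1, 1; -1, 0], by simp [Matrix.det_fin_two]⟩

/-- The generator `𝕐`, whose square is `-1` in `SL(2, ℤ)`. -/
def matY : SL(2, ℤ) := ⟨!![0, -1; 1, 0], by simp [Matrix.det_fin_two]⟩

/-- The projection `SL(2, ℤ) → PSL(2, ℤ)`. -/
def toPSL : SL(2, ℤ) →* PSL(2, ℤ) :=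
  QuotientGroup.mk' (Subgroup.center SL(2, ℤ))

/-- A `PSL(2, ℤ)`-valued factorization is simple if each entry is conjugate to `𝕏𝕐`. -/
def IsSimple {r : ℕ} (m : Factorization PSL(2, ℤ) r) : Prop :=
  ∀ i, IsConj (toPSL (matX * matY)) (m i)

/-! ### The simple lift to `SL(2, ℤ)` -/

theorem trace_of_isConj {A : SL(2, ℤ)} (h : IsConj (matX * matY) A) :
    Matrix.trace (A : Matrix (Fin 2) (Fin 2) ℤ) = 2 := by
  obtain ⟨c, rfl⟩ := isConj_iff.1 h
  rw [Matrix.SpecialLinearGroup.coe_mul, Matrix.trace_mul_comm,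
    ← Matrix.SpecialLinearGroup.coe_mul, inv_mul_cancel_left]
  decide

/-- An element of `PSL(2, ℤ)` conjugate to `𝕏𝕐` has one and only one lift to `SL(2, ℤ)` that is
conjugate to `𝕏𝕐` in `SL(2, ℤ)`. -/
theorem existsUnique_simpleLift {g : PSL(2, ℤ)} (hg : IsConj (toPSL (matX * matY)) g) :
    ∃! A : SL(2, ℤ), IsConj (matX * matY) A ∧ toPSL A = g := by
  obtain ⟨c, rfl⟩ := isConj_iff.1 hg
  obtain ⟨C, rfl⟩ := QuotientGroup.mk'_surjective _ c
  refine ⟨C * (matX * matY) * C⁻¹, ⟨isConj_iff.2 ⟨C, rfl⟩, by simp [toPSL]⟩, ?_⟩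
  rintro A ⟨hA, hAg⟩
  have hB : IsConj (matX * matY) (C * (matX * matY) * C⁻¹) := isConj_iff.2 ⟨C, rfl⟩
  have hAB : toPSL (C * (matX * matY) * C⁻¹) = toPSL A := by rw [hAg]; simp [toPSL]
  generalize C * (matX * matY) * C⁻¹ = B at hB hAB
  have hz : B⁻¹ * A ∈ Subgroup.center SL(2, ℤ) := QuotientGroup.eq.1 hAB
  obtain ⟨z, hz2, hz⟩ := Matrix.SpecialLinearGroup.mem_center_iff.1 hz
  have hA' : (A : Matrix (Fin 2) (Fin 2) ℤ) = z • (B : Matrix (Fin 2) (Fin 2) ℤ) := by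
    have : A = B * (B⁻¹ * A) := by group
    rw [this, Matrix.SpecialLinearGroup.coe_mul, ← hz, Matrix.scalar_apply,
      ← Matrix.smul_one_eq_diagonal, Matrix.mul_smul, Matrix.mul_one]
  have htA := trace_of_isConj hA
  rw [hA', Matrix.trace_smul, trace_of_isConj hB, smul_eq_mul] at htA
  obtain rfl : z = 1 := by omega
  ext i j
  simp [hA']

/-- The lift to `SL(2, ℤ)` of an element of `PSL(2, ℤ)` conjugate to `𝕏𝕐`: the unique lift
conjugate to `𝕏𝕐` in `SL(2, ℤ)` (an unspecified value on the other elements). -/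
noncomputable def simpleLift (g : PSL(2, ℤ)) : SL(2, ℤ) :=
  Classical.epsilon fun A : SL(2, ℤ) => IsConj (matX * matY) A ∧ toPSL A = g

theorem simpleLift_spec {g : PSL(2, ℤ)} (hg : IsConj (toPSL (matX * matY)) g) :
    IsConj (matX * matY) (simpleLift g) ∧ toPSL (simpleLift g) = g :=
  Classical.epsilon_spec (p := fun A : SL(2, ℤ) => IsConj (matX * matY) A ∧ toPSL A = g)
    (existsUnique_simpleLift hg).exists

/-! ### The transcendental lattice -/

section Lattice

open Matrix

/-- The skew-symmetric form on `ℤ² = ℤa ⊕ ℤb` with `a · b = 1`. -/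
def skew (x y : Fin 2 → ℤ) : ℤ := x 0 * y 1 - x 1 * y 0

variable {r : ℕ} (m : Factorization SL(2, ℤ) r)

/-- The map `χ : ⨁ᵢ ℤ² → ℤ²`, `(xᵢ) ↦ ∑ᵢ (mᵢ - 1) xᵢ`. -/
def chi : (Fin r → Fin 2 → ℤ) →ₗ[ℤ] (Fin 2 → ℤ) :=
  ∑ i, ((m i : Matrix (Fin 2) (Fin 2) ℤ).mulVecLin - LinearMap.id).comp (LinearMap.proj i)

/-- The quadratic map
`q(x) = -∑ᵢ xᵢ · mᵢxᵢ + ∑_{i<j} (mᵢ - 1)xᵢ · (mⱼ - 1)xⱼ` on `⨁ᵢ ℤ²`. -/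
def quad (x : Fin r → Fin 2 → ℤ) : ℤ :=
  -(∑ i, skew (x i) ((m i : Matrix (Fin 2) (Fin 2) ℤ) *ᵥ x i)) +
    ∑ i, ∑ j ∈ Finset.Ioi i,
      skew ((m i : Matrix (Fin 2) (Fin 2) ℤ) *ᵥ x i - x i)
        ((m j : Matrix (Fin 2) (Fin 2) ℤ) *ᵥ x j - x j)

/-- The kernel of `χ`. -/
abbrev chiKer : Submodule ℤ (Fin r → Fin 2 → ℤ) := LinearMap.ker (chi m)

/-- The submodule of those `x ∈ ker χ` with `q(y + x) = q(y)` for all `y ∈ ker χ`. -/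
def radical : Submodule ℤ (chiKer m) :=
  AddSubgroup.toIntSubmodule
    { carrier := {x | ∀ y : chiKer m, quad m ↑(y + x) = quad m ↑y}
      zero_mem' := fun y => by rw [add_zero]
      add_mem' := fun {a b} ha hb y => by rw [← add_assoc, hb, ha]
      neg_mem' := fun {a} ha y => by
        have h := ha (y + -a)
        rw [neg_add_cancel_right] at h
        exact h.symm }

theorem mem_radical {x : chiKer m} :
    x ∈ radical m ↔ ∀ y : chiKer m, quad m ↑(y + x) = quad m ↑y :=
  Iff.rfl

/-- The underlying abelian group of the transcendental lattice of an `SL(2, ℤ)`-valued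
factorization. -/
abbrev TranscendentalLattice : Type := chiKer m ⧸ radical m

/-- The quadratic form on the transcendental lattice induced by `q`. -/
def latticeForm : TranscendentalLattice m → ℤ :=
  Quotient.lift (fun x : chiKer m => quad m ↑x) fun x y h => by
    have h' : x - y ∈ radical m := (Submodule.quotientRel_def _).1 h
    have := (mem_radical m).1 h' y
    rwa [add_sub_cancel] at this

/-- Two factorizations have isomorphic (isometric) transcendental lattices. -/
def SameTranscendentalLattice {r s : ℕ} (m : Factorization SL(2, ℤ) r)
    (m' : Factorization SL(2, ℤ) s) : Prop :=
  ∃ e : TranscendentalLattice m ≃ₗ[ℤ] TranscendentalLattice m',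
    ∀ x, latticeForm m' (e x) = latticeForm m x

end Lattice

/-! ### The braid group on three strands and the fundamental group -/

/-- The braid relation `σ₁σ₂σ₁ = σ₂σ₁σ₂`, as a relator. -/
def braidRels : Set (FreeGroup (Fin 2)) :=
  {FreeGroup.of 0 * FreeGroup.of 1 * FreeGroup.of 0 *
    (FreeGroup.of 1 * FreeGroup.of 0 * FreeGroup.of 1)⁻¹}

/-- The braid group `𝔹₃`. -/
abbrev B3 : Type := PresentedGroup braidRels

/-- The Artin generators `σ₁ = sigma 0` and `σ₂ = sigma 1`. -/
def sigma (i : Fin 2) : B3 := PresentedGroup.of i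

/-- The homomorphism `𝔹₃ → G` that sends `σ₁`, `σ₂` to elements `s`, `t` with `sts = tst`. -/
def braidLift {G : Type*} [Group G] (s t : G) (h : s * t * s = t * s * t) : B3 →* G :=
  PresentedGroup.toGroup (f := ![s, t]) (rels := braidRels) (by
    rintro _ rfl
    simp [h])

/-- The epimorphism `𝔹₃ → SL(2, ℤ)`, `σ₁ ↦ 𝕏𝕐`, `σ₂ ↦ 𝕏²𝕐𝕏⁻¹`. -/
def braidToSL : B3 →* SL(2, ℤ) :=
  braidLift (matX * matY) (matX ^ 2 * matY * matX⁻¹) (by decide)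

/-- The epimorphism `𝔹₃ → PSL(2, ℤ)`. -/
def braidToPSL : B3 →* PSL(2, ℤ) := toPSL.comp braidToSL

/-- The automorphism of the free group `⟨α₁, α₂, α₃⟩` by which the Artin generator `σ_{i+1}` acts,
for `a = α_{i+1}`, `b = α_{i+2}`: `a ↦ a b a⁻¹`, `b ↦ a`, the third generator being fixed. -/
def artinGen (a b : Fin 3) (hab : a ≠ b) : MulAut (FreeGroup (Fin 3)) :=
  MonoidHom.toMulEquiv
    (FreeGroup.lift fun j =>
      if j = a then FreeGroup.of a * FreeGroup.of b * (FreeGroup.of a)⁻¹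
      else if j = b then FreeGroup.of a else FreeGroup.of j)
    (FreeGroup.lift fun j =>
      if j = a then FreeGroup.of b
      else if j = b then (FreeGroup.of b)⁻¹ * FreeGroup.of a * FreeGroup.of b
      else FreeGroup.of j)
    (by
      ext j
      by_cases h1 : j = a
      · subst h1; simp [hab.symm, mul_assoc]
      · by_cases h2 : j = b
        · subst h2; simp [h1]
        · simp [h1, h2])
    (by
      ext j
      by_cases h1 : j = a
      · subst h1; simp [hab.symm]
      · by_cases h2 : j = b
        · subst h2; simp [h1, mul_assoc]
        · simp [h1, h2])

/-- The Artin action of `𝔹₃` on the free group `⟨α₁, α₂, α₃⟩`. -/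
def artin : B3 →* MulAut (FreeGroup (Fin 3)) :=
  braidLift (artinGen 0 1 (by decide)) (artinGen 1 2 (by decide)) (by
    apply MulEquiv.toMonoidHom_injective
    ext j
    fin_cases j <;> simp [artinGen, mul_assoc])

/-- The (affine) fundamental group
`⟨α₁, α₂, α₃ | β(αⱼ) = αⱼ for β ∈ S, j = 1, 2, 3⟩`
of a collection `S` of braids on three strands. -/
abbrev braidFundamentalGroup (S : Set B3) : Type :=
  PresentedGroup {w : FreeGroup (Fin 3) | ∃ β ∈ S, ∃ j : Fin 3,
    w = artin β (FreeGroup.of j) * (FreeGroup.of j)⁻¹}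

/-- The braids conjugate to `σ₁` that lift the entries of a `PSL(2, ℤ)`-valued factorization.
Since `𝔹₃ → PSL(2, ℤ)` is a central extension whose kernel is generated by an element of
degree `6`, every entry of a simple factorization has exactly one such lift. -/
def simpleBraidLifts {r : ℕ} (m : Factorization PSL(2, ℤ) r) : Set B3 :=
  {β | IsConj (sigma 0) β ∧ ∃ i, braidToPSL β = m i}

/-- The fundamental group of a simple `PSL(2, ℤ)`-valued factorization, that is, of its simple
`𝔹₃`-valued lift. -/
abbrev SimpleFundamentalGroup {r : ℕ} (m : Factorization PSL(2, ℤ) r) : Type :=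
  braidFundamentalGroup (simpleBraidLifts m)

/-! ### The count -/

/-- `T̃(k) = (5k + 4) C(k) / (k + 2)`, where `C(k)` is the `k`-th Catalan number. -/
def Ttilde (k : ℕ) : ℕ := (5 * k + 4) * catalan k / (k + 2)

/-- The division in the definition of `T̃(k)` is exact. -/
theorem Ttilde_mul (k : ℕ) : (k + 2) * Ttilde k = (5 * k + 4) * catalan k := by
  have h1 := succ_mul_catalan_eq_centralBinom k
  have h2 := succ_mul_catalan_eq_centralBinom (k + 1)
  have h3 := Nat.succ_mul_centralBinom_succ k
  rw [← h1, ← h2] at h3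
  have h4 : (k + 2) * catalan (k + 1) = 2 * (2 * k + 1) * catalan k := by
    refine Nat.eq_of_mul_eq_mul_left (Nat.succ_pos k) ?_
    simp only [Nat.succ_eq_add_one] at h3 ⊢
    linarith
  have h5 : (5 * k + 4) * catalan k = (k + 2) * (catalan (k + 1) + catalan k) := by
    linarith
  rw [Ttilde, h5, Nat.mul_div_cancel_left _ (by omega)]

end BraidMonodromy

open BraidMonodromy

namespace BraidMonodromy

open BinaryTree

/-! ### Factorizations attached to binary trees -/

section Trees

variable {G : Type*} [Group G] {r s : ℕ}

/-! A plane trivalent tree with `k + 2` leaves becomes a ribbon graph when a loop is attached to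
each leaf. A subgroup of `PSL(2, ℤ)` of finite index is the stabilizer of a flag in such a graph,
with `𝕏` rotating about the vertices and `𝕐` flipping the edges. Here the loops at the leaves give
generators conjugate to `𝕏𝕐`, whose ordered product goes once around the outer face, of length `5k +
4`. A base point on the outer face fixes the monodromy at infinity itself, not just its conjugacy
class. It lies on a side of a tree edge or on a loop. The first kind amounts to an ordered pair of
rooted binary trees joined at their roots (`catalan (k + 1)` choices), the second to a tree joined
to a leaf, with the base point moved by `(𝕏𝕐)⁻¹` (`catalan k` choices). The sum is `Ttilde k`.

The monodromy groups differ because a subgroup remembers its pointed graph: `HasBranch` reads off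
the shapes of the branches, and membership of `𝕏⁻¹𝕐` tells the two kinds apart. The index is
squeezed between a covering of the coset space by two branches and the stabilizer in an explicit
action on flags (`joinedGroup_properties`); that action exists because `PSL(2, ℤ)` is a free product
(`exists_modularHom`).

The lattice is computed by induction on the tree. `HasBranchForm` diagonalizes `q` up to a
hyperbolic term in `χ` and records the single linear relation on the coordinates. After joining, the
hyperbolic terms cancel and only a negative definite lattice depending on `k` remains
(`hasStandardForm_joined`).

For the fundamental group, the braid relations of a sufficiently large tree identify all three
generators (`BranchRelation.eq_of_joined`), while the degree map shows that the resulting cyclic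
group is infinite. With fewer than four leaves the branch shapes are unique up to exchanging the two
sides. -/

/-- Simultaneous conjugation of the entries of a factorization. -/
def conjFactorization (g : G) (m : Factorization G r) : Factorization G r :=
  fun i => g * m i * g⁻¹

theorem conjFactorization_mul (g h : G) (m : Factorization G r) :
    conjFactorization (g * h) m = conjFactorization g (conjFactorization h m) := by
  funext i
  simp [conjFactorization, mul_assoc]

theorem conjFactorization_append (g : G) (m : Factorization G r) (m' : Factorization G s) :
    conjFactorization g (Fin.append m m') =
      Fin.append (conjFactorization g m) (conjFactorization g m') := by
  funext i
  induction i using Fin.addCases <;> simp [conjFactorization]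

theorem monodromyAtInfinity_append (m : Factorization G r) (m' : Factorization G s) :
    monodromyAtInfinity (Fin.append m m' : Factorization G (r + s)) =
      monodromyAtInfinity m' * monodromyAtInfinity m := by
  simp [monodromyAtInfinity, List.ofFn_fin_append]

theorem monodromyAtInfinity_conj (g : G) (m : Factorization G r) :
    monodromyAtInfinity (conjFactorization g m) = g * monodromyAtInfinity m * g⁻¹ := by
  have h : List.ofFn (conjFactorization g m) = (List.ofFn m).map (MulAut.conj g) := by
    rw [List.map_ofFn]
    rfl
  rw [monodromyAtInfinity, h, ← List.map_reverse, ← map_list_prod]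
  rfl

theorem range_append {α : Type*} {r s : ℕ} (m : Fin r → α) (m' : Fin s → α) :
    Set.range (Fin.append m m') = Set.range m ∪ Set.range m' := by
  ext a
  constructor
  · rintro ⟨i, rfl⟩
    induction i using Fin.addCases <;> simp
  · rintro (⟨i, rfl⟩ | ⟨i, rfl⟩)
    · exact ⟨Fin.castAdd s i, by simp⟩
    · exact ⟨Fin.natAdd r i, by simp⟩

theorem range_conjFactorization (g : G) (m : Factorization G r) :
    Set.range (conjFactorization g m) = MulAut.conj g '' Set.range m := by
  rw [← Set.range_comp]
  rfl

/-- The factorization of a rooted binary tree, in a group with two distinguished elements `x` and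
`y`. Each leaf carries a loop; the entries are the conjugates of `x * y` that correspond to these
loops. -/
def branch (x y : G) : (t : BinaryTree Unit) → Factorization G t.numLeaves
  | nil => fun _ => x * (x * y) * x⁻¹
  | node _ l r => Fin.append (conjFactorization (x * y) (branch x y l))
      (conjFactorization (x⁻¹ * y) (branch x y r))

/-- The factorization of the tree obtained by joining the roots of two rooted binary trees. -/
def joined (x y : G) (l r : BinaryTree Unit) : Factorization G (l.numLeaves + r.numLeaves) :=
  Fin.append (branch x y l) (conjFactorization y (branch x y r))

theorem isConj_branch (x y : G) (t : BinaryTree Unit) (i : Fin t.numLeaves) :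
    IsConj (x * y) (branch x y t i) := by
  induction t with
  | nil => exact isConj_iff.2 ⟨x, rfl⟩
  | node _ l r hl hr =>
    change Fin (l.numLeaves + r.numLeaves) at i
    induction i using Fin.addCases with
    | left i =>
      simp only [branch, Fin.append_left]
      exact (hl i).trans (isConj_iff.2 ⟨_, rfl⟩)
    | right i =>
      simp only [branch, Fin.append_right]
      exact (hr i).trans (isConj_iff.2 ⟨_, rfl⟩)

theorem isConj_joined (x y : G) (l r : BinaryTree Unit) (i : Fin (l.numLeaves + r.numLeaves)) :
    IsConj (x * y) (joined x y l r i) := by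
  induction i using Fin.addCases with
  | left i =>
    simp only [joined, Fin.append_left]
    exact isConj_branch x y l i
  | right i =>
    simp only [joined, Fin.append_right]
    exact (isConj_branch x y r i).trans (isConj_iff.2 ⟨_, rfl⟩)

theorem map_conjFactorization {H : Type*} [Group H] (f : G →* H) (g : G) (m : Factorization G r) :
    f ∘ conjFactorization g m = conjFactorization (f g) (f ∘ m) := by
  funext i
  simp [conjFactorization]

theorem comp_append {α β : Type*} {r s : ℕ} (f : α → β) (m : Fin r → α) (m' : Fin s → α) :
    f ∘ Fin.append m m' = Fin.append (f ∘ m) (f ∘ m') := by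
  funext i
  induction i using Fin.addCases <;> simp

theorem map_branch {H : Type*} [Group H] (f : G →* H) (x y : G) (t : BinaryTree Unit) :
    f ∘ branch x y t = branch (f x) (f y) t := by
  induction t with
  | nil =>
    funext i
    change f (x * (x * y) * x⁻¹) = f x * (f x * f y) * (f x)⁻¹
    simp
  | node _ l r hl hr =>
    rw [branch, branch, ← hl, ← hr, ← map_mul, ← map_inv, ← map_mul, ← map_conjFactorization,
      ← map_conjFactorization]
    exact comp_append _ _ _

theorem map_joined {H : Type*} [Group H] (f : G →* H) (x y : G) (l r : BinaryTree Unit) :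
    f ∘ joined x y l r = joined (f x) (f y) l r := by
  rw [joined, joined, ← map_branch, ← map_branch, ← map_conjFactorization]
  exact comp_append _ _ _

/-- Each branch contributes a power of `A = x * y`. At a node the two conjugations leave `y * A ^ (2
- 5 * r) * (y * x)` and `x * A ^ (2 - 5 * l)`, where `l` and `r` are the leaf counts; since `y * x *
x = A⁻¹`, the exponents add up to `3 - 5 * (l + r)`. -/
theorem monodromyAtInfinity_branch {x y : G} (hx : x ^ 3 = 1) (hy : y ^ 2 = 1)
    (t : BinaryTree Unit) :
    monodromyAtInfinity (branch x y t) = y * (x * y) ^ (3 - 5 * (t.numLeaves : ℤ)) := by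
  have hyy : y * y = 1 := by rwa [← pow_two]
  have hy' : y⁻¹ = y := inv_eq_of_mul_eq_one_left hyy
  have hyl : ∀ z, y * (y * z) = z := fun z => by rw [← mul_assoc, hyy, one_mul]
  have hx' : x⁻¹ = x * x := inv_eq_of_mul_eq_one_left (by rw [← hx, pow_succ, pow_two])
  have hX : x = x * y * y := by rw [mul_assoc, hyy, mul_one]
  have hX' : x⁻¹ = y * (x * y) ^ (-1 : ℤ) := by
    rw [zpow_neg_one, mul_inv_rev, mul_inv_cancel_left]
  induction t with
  | nil =>
    have h1 : (x * y) ^ (3 - 5 * ((nil : BinaryTree Unit).numLeaves : ℤ)) =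
        (x * y)⁻¹ * (x * y)⁻¹ := by
      rw [← zpow_neg_one, ← zpow_add]
      norm_num
    rw [h1, monodromyAtInfinity]
    simp [branch, hy', hx', mul_assoc]
    simp [← mul_assoc, hyy]
  | node _ l r hl hr =>
    change monodromyAtInfinity (Fin.append _ _ : Factorization G (_ + _)) = _
    rw [monodromyAtInfinity_append, monodromyAtInfinity_conj, monodromyAtInfinity_conj, hl, hr]
    generalize hA : x * y = A at *
    have e1 : A * (y * A ^ (3 - 5 * (l.numLeaves : ℤ))) * A⁻¹ =
        x * A ^ (2 - 5 * (l.numLeaves : ℤ)) := by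
      rw [← mul_assoc, ← hX, mul_assoc, ← zpow_neg_one, ← zpow_add]
      congr 2
      ring
    have e2 : x⁻¹ * y * (y * A ^ (3 - 5 * (r.numLeaves : ℤ))) * (x⁻¹ * y)⁻¹ =
        y * A ^ (2 - 5 * (r.numLeaves : ℤ)) * (y * x) := by
      rw [mul_inv_rev, inv_inv, hy', mul_assoc x⁻¹, hyl, hX', mul_assoc y, ← zpow_add]
      congr 3
      ring
    have e3 : y * x * x = A ^ (-1 : ℤ) := by
      rw [mul_assoc, ← hx', zpow_neg_one, ← hA, mul_inv_rev, hy']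
    rw [e1, e2, ← mul_assoc, mul_assoc _ (y * x) x, e3, mul_assoc y, mul_assoc y, ← zpow_add,
      ← zpow_add]
    congr 2
    simp only [numLeaves, Nat.cast_add]
    ring

theorem monodromyAtInfinity_joined {x y : G} (hx : x ^ 3 = 1) (hy : y ^ 2 = 1)
    (l r : BinaryTree Unit) :
    monodromyAtInfinity (joined x y l r) =
      (x * y) ^ (6 - 5 * ((l.numLeaves + r.numLeaves : ℕ) : ℤ)) := by
  have hyy : y * y = 1 := by rwa [← pow_two]
  have hy' : y⁻¹ = y := inv_eq_of_mul_eq_one_left hyy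
  have hyl : ∀ z, y * (y * z) = z := fun z => by rw [← mul_assoc, hyy, one_mul]
  rw [joined, monodromyAtInfinity_append, monodromyAtInfinity_conj,
    monodromyAtInfinity_branch hx hy, monodromyAtInfinity_branch hx hy, hy', hyl,
    mul_assoc, hyl, ← zpow_add]
  congr 1
  push_cast
  ring

end Trees

/-! ### The modular group as a free product -/

/-- The image of `𝕏` in `PSL(2, ℤ)`. -/
def projX : PSL(2, ℤ) := toPSL matX

/-- The image of `𝕐` in `PSL(2, ℤ)`. -/
def projY : PSL(2, ℤ) := toPSL matY

theorem offDiag_of_toPSL_eq_one {A : SL(2, ℤ)} (h : toPSL A = 1) : A 0 1 = 0 ∧ A 1 0 = 0 := by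
  obtain ⟨z, -, hz⟩ := Matrix.SpecialLinearGroup.mem_center_iff.1
    ((QuotientGroup.eq_one_iff A).1 h)
  rw [← hz, Matrix.scalar_apply]
  exact ⟨Matrix.diagonal_apply_ne _ (by decide), Matrix.diagonal_apply_ne _ (by decide)⟩

theorem toPSL_neg (A : SL(2, ℤ)) : toPSL (-A) = toPSL A := by
  refine (QuotientGroup.eq.2 ?_).symm
  rw [Matrix.SpecialLinearGroup.mem_center_iff]
  refine ⟨-1, by simp, ?_⟩
  have : A⁻¹ * -A = -1 := by simp
  rw [this]
  ext i j
  fin_cases i <;> fin_cases j <;> simp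

theorem matX_pow : matX ^ 3 = 1 := by decide

theorem projX_pow : projX ^ 3 = 1 := by
  rw [projX, ← map_pow, matX_pow, map_one]

theorem projY_pow : projY ^ 2 = 1 := by
  rw [projY, ← map_pow, show matY ^ 2 = -1 by decide, toPSL_neg, map_one]

theorem closure_matX_matY : Subgroup.closure {matX, matY} = ⊤ := by
  rw [← top_le_iff, ← SpecialLinearGroup.SL2Z_generators, Subgroup.closure_le]
  have hX : matX ∈ Subgroup.closure {matX, matY} := Subgroup.subset_closure (by simp)
  have hY : matY ∈ Subgroup.closure {matX, matY} := Subgroup.subset_closure (by simp)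
  rintro g (rfl | rfl)
  · rwa [show ModularGroup.S = matY by decide]
  · rw [show ModularGroup.T = matX * matY by decide]
    exact mul_mem hX hY

theorem toPSL_surjective : Function.Surjective toPSL := QuotientGroup.mk'_surjective _

theorem closure_projX_projY : Subgroup.closure {projX, projY} = ⊤ := by
  have h : ({projX, projY} : Set PSL(2, ℤ)) = toPSL '' {matX, matY} := by
    simp [Set.image_pair, projX, projY]
  rw [h, ← MonoidHom.map_closure, closure_matX_matY, ← MonoidHom.range_eq_map,
    MonoidHom.range_eq_top]
  exact toPSL_surjective

/-- The product of the elements `x * y` and `x⁻¹ * y` in the order given by a word. -/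
def turnWord {G : Type*} [Group G] (x y : G) (w : List Bool) : G :=
  (w.map fun b => if b then x * y else x⁻¹ * y).prod

theorem map_turnWord {G H : Type*} [Group G] [Group H] (f : G →* H) (x y : G) (w : List Bool) :
    f (turnWord x y w) = turnWord (f x) (f y) w := by
  induction w with
  | nil => simp [turnWord]
  | cons b w ih =>
    simp only [turnWord, List.map_cons, List.prod_cons, map_mul] at ih ⊢
    rw [ih]
    cases b <;> simp

/-- In a group generated by `x` and `y` with `x ^ 3 = 1`, `y ^ 2 = 1`, every element has a
normal form. -/
theorem exists_normalForm {G : Type*} [Group G] {x y : G} (hx : x ^ 3 = 1) (hy : y ^ 2 = 1)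
    {g : G} (hg : g ∈ Subgroup.closure {x, y}) :
    ∃ (e : Fin 2) (w : List Bool) (i : Fin 3),
      g = y ^ (e : ℕ) * turnWord x y w * x ^ (i : ℕ) := by
  have hyy : y * y = 1 := by rwa [← pow_two]
  have hy' : y⁻¹ = y := inv_eq_of_mul_eq_one_left hyy
  have hxx : x * x = x⁻¹ := (inv_eq_of_mul_eq_one_left (by rw [← hx, pow_succ, pow_two])).symm
  have stepX : ∀ g : G, (∃ (e : Fin 2) (w : List Bool) (i : Fin 3),
      g = y ^ (e : ℕ) * turnWord x y w * x ^ (i : ℕ)) → ∃ (e : Fin 2) (w : List Bool) (i : Fin 3),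
      x * g = y ^ (e : ℕ) * turnWord x y w * x ^ (i : ℕ) := by
    rintro g ⟨e, w, i, rfl⟩
    fin_cases e
    · cases w with
      | nil =>
        fin_cases i
        · exact ⟨0, [], 1, by simp [turnWord]⟩
        · exact ⟨0, [], 2, by simp [turnWord, pow_two]⟩
        · exact ⟨0, [], 0, by simp [turnWord, ← pow_succ', hx]⟩
      | cons b w =>
        cases b
        · exact ⟨1, w, i, by simp [turnWord, mul_assoc]⟩
        · refine ⟨0, false :: w, i, ?_⟩
          simp [turnWord, mul_assoc, ← hxx]
    · exact ⟨0, true :: w, i, by simp [turnWord, mul_assoc]⟩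
  have stepY : ∀ g : G, (∃ (e : Fin 2) (w : List Bool) (i : Fin 3),
      g = y ^ (e : ℕ) * turnWord x y w * x ^ (i : ℕ)) → ∃ (e : Fin 2) (w : List Bool) (i : Fin 3),
      y * g = y ^ (e : ℕ) * turnWord x y w * x ^ (i : ℕ) := by
    rintro g ⟨e, w, i, rfl⟩
    fin_cases e
    · exact ⟨1, w, i, by simp [mul_assoc]⟩
    · exact ⟨0, w, i, by simp [← mul_assoc, hyy]⟩
  induction hg using Subgroup.closure_induction_left with
  | one => exact ⟨0, [], 0, by simp [turnWord]⟩
  | mul_left a ha b _ ih =>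
    rcases ha with rfl | rfl
    · exact stepX _ ih
    · exact stepY _ ih
  | inv_mul_cancel a ha b _ ih =>
    rcases ha with rfl | rfl
    · rw [← hxx, mul_assoc]
      exact stepX _ (stepX _ ih)
    · rw [hy']
      exact stepY _ ih

/-- A lift to `SL(2, ℤ)` with nonnegative entries of a word in `𝕏𝕐` and `𝕏⁻¹𝕐`. -/
theorem exists_nonneg_lift (w : List Bool) :
    ∃ A : SL(2, ℤ), toPSL A = turnWord projX projY w ∧ 1 ≤ A 0 0 ∧ 1 ≤ A 1 1 ∧ 0 ≤ A 0 1 ∧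
      0 ≤ A 1 0 ∧ (A 0 1 = 0 → A 1 0 = 0 → w = []) := by
  induction w with
  | nil => exact ⟨1, by simp [turnWord], by simp, by simp, by simp, by simp, by simp⟩
  | cons b w ih =>
    obtain ⟨A, hA, h00, h11, h01, h10, -⟩ := ih
    cases b
    -- The sign, invisible in `PSL(2, ℤ)`, turns `𝕏⁻¹𝕐` into the lower unipotent matrix with
    -- nonnegative entries.
    · refine ⟨-(matX⁻¹ * matY) * A, ?_, ?_⟩
      · rw [map_mul, hA, toPSL_neg]
        simp [turnWord, projX, projY]
      · have e : ∀ j, (-(matX⁻¹ * matY) * A) 0 j = A 0 j ∧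
            (-(matX⁻¹ * matY) * A) 1 j = A 0 j + A 1 j := by
          intro j
          have hM : ((-(matX⁻¹ * matY) : SL(2, ℤ)) : Matrix (Fin 2) (Fin 2) ℤ) =
              !![1, 0; 1, 1] := by
            decide
          rw [Matrix.SpecialLinearGroup.coe_mul, hM]
          simp [Matrix.mul_apply, Fin.sum_univ_two]
        rw [(e 0).1, (e 0).2, (e 1).1, (e 1).2]
        exact ⟨by omega, by omega, by omega, by omega, by omega⟩
    · refine ⟨(matX * matY) * A, ?_, ?_⟩
      · rw [map_mul, hA]
        simp [turnWord, projX, projY]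
      · have e : ∀ j, (matX * matY * A) 0 j = A 0 j + A 1 j ∧
            (matX * matY * A) 1 j = A 1 j := by
          intro j
          have hM : ((matX * matY : SL(2, ℤ)) : Matrix (Fin 2) (Fin 2) ℤ) = !![1, 1; 0, 1] := by
            decide
          rw [Matrix.SpecialLinearGroup.coe_mul, hM]
          simp [Matrix.mul_apply, Fin.sum_univ_two]
        rw [(e 0).1, (e 0).2, (e 1).1, (e 1).2]
        exact ⟨by omega, by omega, by omega, by omega, by omega⟩

/-- A central matrix is diagonal. If `A` is nonnegative with diagonal entries at least `1`,
multiplying by a nontrivial `matY ^ e` or `matX ^ i` moves a diagonal entry, or a sum containing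
one, off the diagonal up to sign. So `e = i = 0`, and a diagonal lift `A` comes only from the empty
word. -/
theorem eq_of_normalForm_eq_one {e : Fin 2} {w : List Bool} {i : Fin 3}
    (h : projY ^ (e : ℕ) * turnWord projX projY w * projX ^ (i : ℕ) = 1) :
    e = 0 ∧ w = [] ∧ i = 0 := by
  obtain ⟨A, hA, h00, h11, h01, h10, hw⟩ := exists_nonneg_lift w
  have h' : toPSL (matY ^ (e : ℕ) * A * matX ^ (i : ℕ)) = 1 := by
    rw [map_mul, map_mul, map_pow, map_pow, hA]
    exact h
  obtain ⟨o1, o2⟩ := offDiag_of_toPSL_eq_one h'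
  obtain rfl | rfl : e = 0 ∨ e = 1 := by omega
  all_goals obtain rfl | rfl | rfl : i = 0 ∨ i = 1 ∨ i = 2 := by omega
  all_goals
    simp only [Fin.val_zero, Fin.val_one, Fin.val_two, pow_zero, pow_one, one_mul, mul_one,
      pow_two, Matrix.SpecialLinearGroup.coe_mul] at o1 o2
    simp [matX, matY, Matrix.mul_apply, Fin.sum_univ_two, Matrix.vecMul, dotProduct]
      at o1 o2 ⊢
  · exact hw o1 o2
  all_goals omega

/-- `PSL(2, ℤ)` is the free product of the cyclic groups generated by `𝕏` and `𝕐`. -/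
theorem exists_modularHom {G : Type*} [Group G] {x y : G} (hx : x ^ 3 = 1) (hy : y ^ 2 = 1) :
    ∃ f : PSL(2, ℤ) →* G, f projX = x ∧ f projY = y := by
  -- `K` is the graph of the desired homomorphism. It is single-valued because its elements have
  -- normal forms too, and a normal form that is trivial in `PSL(2, ℤ)` is the empty one.
  let K : Subgroup (PSL(2, ℤ) × G) := Subgroup.closure {(projX, x), (projY, y)}
  have hKX : (projX, x) ∈ K := Subgroup.subset_closure (by simp)
  have hKY : (projY, y) ∈ K := Subgroup.subset_closure (by simp)
  let p : K →* PSL(2, ℤ) := (MonoidHom.fst _ _).comp K.subtype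
  have hinj : Function.Injective p := by
    rw [injective_iff_map_eq_one]
    rintro ⟨g, hg⟩ h1
    change g.1 = 1 at h1
    obtain ⟨e, w, i, rfl⟩ := exists_normalForm (x := (projX, x)) (y := (projY, y))
      (by rw [Prod.pow_mk, projX_pow, hx]; rfl) (by rw [Prod.pow_mk, projY_pow, hy]; rfl) hg
    have h2 := map_turnWord (MonoidHom.fst PSL(2, ℤ) G) (projX, x) (projY, y) w
    simp only [MonoidHom.coe_fst] at h2
    rw [Prod.fst_mul, Prod.fst_mul, Prod.pow_fst, Prod.pow_fst, h2] at h1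
    obtain ⟨rfl, rfl, rfl⟩ := eq_of_normalForm_eq_one h1
    ext1
    simp [turnWord]
  have hsurj : Function.Surjective p := by
    rw [← MonoidHom.range_eq_top, ← top_le_iff, ← closure_projX_projY, Subgroup.closure_le]
    rintro g (rfl | rfl)
    · exact ⟨⟨_, hKX⟩, rfl⟩
    · exact ⟨⟨_, hKY⟩, rfl⟩
  let E : K ≃* PSL(2, ℤ) := MulEquiv.ofBijective p ⟨hinj, hsurj⟩
  have hE : ∀ k : K, E.symm (p k) = k := fun k => E.symm_apply_apply k
  refine ⟨((MonoidHom.snd _ _).comp K.subtype).comp E.symm.toMonoidHom, ?_, ?_⟩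
  · have := hE ⟨_, hKX⟩
    change (E.symm projX : PSL(2, ℤ) × G).2 = x
    change E.symm projX = _ at this
    rw [this]
  · have := hE ⟨_, hKY⟩
    change (E.symm projY : PSL(2, ℤ) × G).2 = y
    change E.symm projY = _ at this
    rw [this]

/-! ### Actions of the modular group: an upper bound for the index -/

theorem projY_inv : projY⁻¹ = projY :=
  inv_eq_of_mul_eq_one_left (by rw [← pow_two, projY_pow])

theorem projX_mul_self : projX * projX = projX⁻¹ :=
  (inv_eq_of_mul_eq_one_left (by rw [← projX_pow, pow_succ, pow_two])).symm

section Action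

variable {Ω : Type*} [MulAction PSL(2, ℤ) Ω]

theorem projY_smul_smul (P : Ω) : projY • projY • P = P := by
  rw [smul_smul, ← pow_two, projY_pow, one_smul]

theorem projX_smul_smul (P : Ω) : projX • projX • P = projX⁻¹ • P := by
  rw [smul_smul, projX_mul_self]

/-- The points of the branch of shape `t` that is rooted at `P`. -/
def branchPoints : BinaryTree Unit → Ω → Set Ω
  | nil, P => {P, projX • P, projX⁻¹ • P}
  | node _ l r, P => {P, projX • P, projX⁻¹ • P} ∪
      (branchPoints l (projY • projX⁻¹ • P) ∪ branchPoints r (projY • projX • P))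

theorem triple_subset_branchPoints (t : BinaryTree Unit) (P : Ω) :
    {P, projX • P, projX⁻¹ • P} ⊆ branchPoints t P := by
  cases t
  · exact subset_rfl
  · exact Set.subset_union_left

theorem mem_branchPoints (t : BinaryTree Unit) (P : Ω) : P ∈ branchPoints t P :=
  triple_subset_branchPoints t P (by simp)

theorem projX_smul_mem_triple {P f : Ω} (hf : f ∈ ({P, projX • P, projX⁻¹ • P} : Set Ω)) :
    projX • f ∈ ({P, projX • P, projX⁻¹ • P} : Set Ω) := by
  rcases hf with rfl | rfl | rfl
  · simp
  · simp [projX_smul_smul]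
  · simp

theorem projX_smul_mem_branchPoints (t : BinaryTree Unit) {P f : Ω} (hf : f ∈ branchPoints t P) :
    projX • f ∈ branchPoints t P := by
  induction t generalizing P with
  | nil => exact projX_smul_mem_triple hf
  | node _ l r hl hr =>
    rcases hf with hf | hf | hf
    · exact Or.inl (projX_smul_mem_triple hf)
    · exact Or.inr (Or.inl (hl hf))
    · exact Or.inr (Or.inr (hr hf))

theorem branch_node_smul_left {u : Unit} {l r : BinaryTree Unit} {P : Ω}
    (h : ∀ i, branch projX projY (node u l r) i • P = P) (i : Fin l.numLeaves) :
    branch projX projY l i • projY • projX⁻¹ • P = projY • projX⁻¹ • P := by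
  have := h (Fin.castAdd r.numLeaves i)
  simp only [branch, Fin.append_left, conjFactorization] at this
  rw [mul_smul, mul_smul, smul_eq_iff_eq_inv_smul, mul_inv_rev, projY_inv, mul_smul] at this
  exact this

theorem branch_node_smul_right {u : Unit} {l r : BinaryTree Unit} {P : Ω}
    (h : ∀ i, branch projX projY (node u l r) i • P = P) (i : Fin r.numLeaves) :
    branch projX projY r i • projY • projX • P = projY • projX • P := by
  have := h (Fin.natAdd l.numLeaves i)
  simp only [branch, Fin.append_right, conjFactorization] at this
  rw [mul_smul, mul_smul, smul_eq_iff_eq_inv_smul, mul_inv_rev, projY_inv, inv_inv, mul_smul]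
    at this
  exact this

/-- The entries of the branch fixing `P` is what closes the loops: at a leaf it says that `𝕐`
exchanges `𝕏P` and `𝕏⁻¹P`. Hence only the root can lead out of the branch. -/
theorem projY_smul_mem_branchPoints (t : BinaryTree Unit) {P f : Ω}
    (h : ∀ i, branch projX projY t i • P = P) (hf : f ∈ branchPoints t P) :
    f = P ∨ projY • f ∈ branchPoints t P := by
  induction t generalizing P with
  | nil =>
    have h0 : projY • projX⁻¹ • P = projX • P := by
      have : (projX * (projX * projY) * projX⁻¹) • P = P := h ⟨0, by simp⟩
      rw [← mul_assoc, projX_mul_self, mul_smul, mul_smul, inv_smul_eq_iff] at this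
      exact this
    rcases hf with rfl | rfl | rfl
    · exact Or.inl rfl
    · rw [← h0, projY_smul_smul, h0]
      exact Or.inr (by simp [branchPoints])
    · rw [h0]
      exact Or.inr (by simp [branchPoints])
  | node _ l r hl hr =>
    rcases hf with hf | hf | hf
    · rcases hf with rfl | rfl | rfl
      · exact Or.inl rfl
      · exact Or.inr (Or.inr (Or.inr (mem_branchPoints _ _)))
      · exact Or.inr (Or.inr (Or.inl (mem_branchPoints _ _)))
    · rcases hl (branch_node_smul_left h) hf with rfl | hf
      · rw [projY_smul_smul]
        exact Or.inr (Or.inl (by simp))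
      · exact Or.inr (Or.inr (Or.inl hf))
    · rcases hr (branch_node_smul_right h) hf with rfl | hf
      · rw [projY_smul_smul]
        exact Or.inr (Or.inl (by simp))
      · exact Or.inr (Or.inr (Or.inr hf))

theorem finite_branchPoints (t : BinaryTree Unit) (P : Ω) : (branchPoints t P).Finite := by
  induction t generalizing P with
  | nil =>
    rw [branchPoints]
    exact Set.toFinite _
  | node _ l r hl hr => exact (Set.toFinite _).union ((hl _).union (hr _))

/-- A binary tree with `n` leaves has `2n - 1` vertices, each carrying at most three points. -/
theorem ncard_branchPoints_le (t : BinaryTree Unit) (P : Ω) :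
    (branchPoints t P).ncard + 3 ≤ 6 * t.numLeaves := by
  have h3 : ∀ P : Ω, ({P, projX • P, projX⁻¹ • P} : Set Ω).ncard ≤ 3 := fun P => by
    refine (Set.ncard_insert_le _ _).trans (Nat.succ_le_succ ?_)
    exact (Set.ncard_insert_le _ _).trans (Nat.succ_le_succ (Set.ncard_singleton _).le)
  induction t generalizing P with
  | nil => exact Nat.add_le_add_right (h3 P) 3
  | node _ l r hl hr =>
    have h1 := Set.ncard_union_le ({P, projX • P, projX⁻¹ • P} : Set Ω)
      (branchPoints l (projY • projX⁻¹ • P) ∪ branchPoints r (projY • projX • P))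
    have h2 := Set.ncard_union_le (branchPoints l (projY • projX⁻¹ • P))
      (branchPoints r (projY • projX • P))
    have := h3 P
    have := hl (projY • projX⁻¹ • P)
    have := hr (projY • projX • P)
    simp only [branchPoints, numLeaves]
    omega

theorem smul_mem_of_closed {S : Set Ω} (hX : ∀ f ∈ S, projX • f ∈ S) (hY : ∀ f ∈ S, projY • f ∈ S)
    (g : PSL(2, ℤ)) {f : Ω} (hf : f ∈ S) : g • f ∈ S := by
  have hg : g ∈ Subgroup.closure {projX, projY} := by
    rw [closure_projX_projY]
    trivial
  induction hg using Subgroup.closure_induction_left with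
  | one => rwa [one_smul]
  | mul_left a ha b _ ih =>
    rw [mul_smul]
    rcases ha with rfl | rfl
    · exact hX _ ih
    · exact hY _ ih
  | inv_mul_cancel a ha b _ ih =>
    rw [mul_smul]
    rcases ha with rfl | rfl
    · rw [← projX_smul_smul]
      exact hX _ (hX _ ih)
    · rw [projY_inv]
      exact hY _ ih

end Action

/-- The monodromy group of the tree obtained by joining the roots of two rooted trees. -/
abbrev joinedGroup (l r : BinaryTree Unit) : Subgroup PSL(2, ℤ) :=
  monodromyGroup (joined projX projY l r)

theorem branch_mem_joinedGroup_left (l r : BinaryTree Unit) (i : Fin l.numLeaves) :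
    branch projX projY l i ∈ joinedGroup l r :=
  Subgroup.subset_closure ⟨Fin.castAdd _ i, by simp [joined]⟩

theorem branch_mem_joinedGroup_right (l r : BinaryTree Unit) (i : Fin r.numLeaves) :
    projY * branch projX projY r i * projY⁻¹ ∈ joinedGroup l r :=
  Subgroup.subset_closure ⟨Fin.natAdd _ i, by simp [joined, conjFactorization]⟩

/-- The branches rooted at the trivial coset `P` and at `𝕐P` form together a set closed under both
generators, hence the whole coset space. Finiteness is recorded because the opposite bound comes
from a divisibility of indices. -/
theorem index_joinedGroup_le (l r : BinaryTree Unit) :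
    (joinedGroup l r).index ≠ 0 ∧
      (joinedGroup l r).index + 6 ≤ 6 * (l.numLeaves + r.numLeaves) := by
  let P : PSL(2, ℤ) ⧸ joinedGroup l r := QuotientGroup.mk 1
  have hP : ∀ g ∈ joinedGroup l r, g • P = P := fun g hg => by
    change QuotientGroup.mk (g * 1) = _
    rw [mul_one]
    exact QuotientGroup.eq.2 (by simpa using hg)
  have hl : ∀ i, branch projX projY l i • P = P := fun i =>
    hP _ (branch_mem_joinedGroup_left l r i)
  have hr : ∀ i, branch projX projY r i • projY • P = projY • P := fun i => by
    have := hP _ (branch_mem_joinedGroup_right l r i)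
    rw [mul_smul, mul_smul, smul_eq_iff_eq_inv_smul, projY_inv] at this
    exact this
  let S := branchPoints l P ∪ branchPoints r (projY • P)
  have hfin : S.Finite := (finite_branchPoints _ _).union (finite_branchPoints _ _)
  have hS : S = Set.univ := by
    rw [Set.eq_univ_iff_forall]
    intro f
    obtain ⟨g, rfl⟩ := QuotientGroup.mk_surjective f
    have : (QuotientGroup.mk g : PSL(2, ℤ) ⧸ joinedGroup l r) = g • P := by
      change _ = QuotientGroup.mk (g * 1)
      rw [mul_one]
    rw [this]
    refine smul_mem_of_closed ?_ ?_ g (Or.inl (mem_branchPoints _ _))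
    · rintro f (hf | hf)
      · exact Or.inl (projX_smul_mem_branchPoints l hf)
      · exact Or.inr (projX_smul_mem_branchPoints r hf)
    · rintro f (hf | hf)
      · rcases projY_smul_mem_branchPoints l hl hf with rfl | hf
        · exact Or.inr (mem_branchPoints _ _)
        · exact Or.inl hf
      · rcases projY_smul_mem_branchPoints r hr hf with rfl | hf
        · rw [projY_smul_smul]
          exact Or.inl (mem_branchPoints _ _)
        · exact Or.inr hf
  have hindex : (joinedGroup l r).index = S.ncard := by
    rw [hS, Set.ncard_univ]
    rfl
  rw [hindex]
  refine ⟨?_, ?_⟩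
  · exact (Set.ncard_pos hfin).2 ⟨P, Or.inl (mem_branchPoints _ _)⟩ |>.ne'
  · have h1 := Set.ncard_union_le (branchPoints l P) (branchPoints r (projY • P))
    have h2 := ncard_branchPoints_le l P
    have h3 := ncard_branchPoints_le r (projY • P)
    change (branchPoints l P ∪ branchPoints r (projY • P)).ncard + 6 ≤ _
    omega

/-! ### The skeleton of a tree -/

/-- The flags (pairs of a vertex and an adjacent half-edge) of the trivalent ribbon graph obtained
from a rooted binary tree by attaching a loop to each leaf. -/
inductive TreeFlag : BinaryTree Unit → Type
  | here {t : BinaryTree Unit} (i : Fin 3) : TreeFlag t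
  | left {u : Unit} {l r : BinaryTree Unit} (f : TreeFlag l) : TreeFlag (node u l r)
  | right {u : Unit} {l r : BinaryTree Unit} (f : TreeFlag r) : TreeFlag (node u l r)

namespace TreeFlag

/-- The rotation about the vertices. -/
def turn : {t : BinaryTree Unit} → TreeFlag t → TreeFlag t
  | _, here i => here (i + 1)
  | _, left f => left (turn f)
  | _, right f => right (turn f)

open Classical in
/-- The involution that exchanges the two halves of each edge; the root half-edge is fixed. -/
noncomputable def flip : {t : BinaryTree Unit} → TreeFlag t → TreeFlag t
  | nil, here i => here (-i)
  | node _ _ _, here i =>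
    if i = 0 then here 0 else if i = 1 then right (here 0) else left (here 0)
  | node _ _ _, left f => if f = here 0 then here 2 else left (flip f)
  | node _ _ _, right f => if f = here 0 then here 1 else right (flip f)

theorem turn_turn_turn {t : BinaryTree Unit} (f : TreeFlag t) : turn (turn (turn f)) = f := by
  induction f with
  | here i =>
    simp only [turn]
    congr 1
    omega
  | left f ih => simp [turn, ih]
  | right f ih => simp [turn, ih]

theorem flip_eq_root {t : BinaryTree Unit} (f : TreeFlag t) : flip f = here 0 ↔ f = here 0 := by
  cases t with
  | nil =>
    cases f with
    | here i =>
      simp only [flip, here.injEq]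
      exact neg_eq_zero
  | node u l r =>
    cases f with
    | here i =>
      simp only [flip]
      split_ifs <;> simp_all
    | left f =>
      simp only [flip]
      split_ifs <;> simp
    | right f =>
      simp only [flip]
      split_ifs <;> simp

theorem flip_flip {t : BinaryTree Unit} (f : TreeFlag t) : flip (flip f) = f := by
  induction t with
  | nil =>
    cases f with
    | here i => simp [flip]
  | node u l r hl hr =>
    cases f with
    | here i =>
      obtain rfl | rfl | rfl : i = 0 ∨ i = 1 ∨ i = 2 := by omega
      all_goals simp [flip]
    | left f =>
      by_cases h : f = here 0
      · simp [flip, h]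
      · simp [flip, h, flip_eq_root, hl]
    | right f =>
      by_cases h : f = here 0
      · simp [flip, h]
      · simp [flip, h, flip_eq_root, hr]

/-- The flags of a leaf. -/
def equivNil : TreeFlag nil ≃ Fin 3 where
  toFun := fun | here i => i
  invFun := here
  left_inv := fun | here _ => rfl
  right_inv _ := rfl

/-- The flags of a tree that is not a leaf. -/
def equivNode (u : Unit) (l r : BinaryTree Unit) :
    TreeFlag (node u l r) ≃ Fin 3 ⊕ (TreeFlag l ⊕ TreeFlag r) where
  toFun := fun
    | here i => Sum.inl i
    | left f => Sum.inr (Sum.inl f)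
    | right f => Sum.inr (Sum.inr f)
  invFun := fun
    | Sum.inl i => here i
    | Sum.inr (Sum.inl f) => left f
    | Sum.inr (Sum.inr f) => right f
  left_inv := by rintro (_ | _ | _) <;> rfl
  right_inv := by rintro (_ | _ | _) <;> rfl

instance finite (t : BinaryTree Unit) : Finite (TreeFlag t) := by
  induction t with
  | nil => exact Finite.of_equiv _ equivNil.symm
  | node u l r hl hr => exact Finite.of_equiv _ (equivNode u l r).symm

theorem card (t : BinaryTree Unit) : Nat.card (TreeFlag t) + 3 = 6 * t.numLeaves := by
  induction t with
  | nil => rw [Nat.card_congr equivNil, Nat.card_fin, numLeaves]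
  | node u l r hl hr =>
    rw [Nat.card_congr (equivNode u l r), Nat.card_sum, Nat.card_sum, Nat.card_fin, numLeaves]
    omega

/-- The rotation of the flags of two trees. -/
def joinedTurn {l r : BinaryTree Unit} : TreeFlag l ⊕ TreeFlag r → TreeFlag l ⊕ TreeFlag r :=
  Sum.map turn turn

open Classical in
/-- The involution of the flags of two trees joined at their roots. -/
noncomputable def joinedFlip {l r : BinaryTree Unit} :
    TreeFlag l ⊕ TreeFlag r → TreeFlag l ⊕ TreeFlag r
  | Sum.inl f => if f = here 0 then Sum.inr (here 0) else Sum.inl (flip f)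
  | Sum.inr f => if f = here 0 then Sum.inl (here 0) else Sum.inr (flip f)

theorem joinedTurn_joinedTurn_joinedTurn {l r : BinaryTree Unit} (f : TreeFlag l ⊕ TreeFlag r) :
    joinedTurn (joinedTurn (joinedTurn f)) = f := by
  cases f <;> simp [joinedTurn, turn_turn_turn]

theorem joinedFlip_joinedFlip {l r : BinaryTree Unit} (f : TreeFlag l ⊕ TreeFlag r) :
    joinedFlip (joinedFlip f) = f := by
  rcases f with f | f
  all_goals
    by_cases h : f = here 0
    · simp [joinedFlip, h]
    · simp [joinedFlip, h, flip_eq_root, flip_flip]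

/-- The rotation as a permutation. -/
def turnPerm (l r : BinaryTree Unit) : Equiv.Perm (TreeFlag l ⊕ TreeFlag r) where
  toFun := joinedTurn
  invFun f := joinedTurn (joinedTurn f)
  left_inv := joinedTurn_joinedTurn_joinedTurn
  right_inv := joinedTurn_joinedTurn_joinedTurn

/-- The involution as a permutation. -/
noncomputable def flipPerm (l r : BinaryTree Unit) : Equiv.Perm (TreeFlag l ⊕ TreeFlag r) where
  toFun := joinedFlip
  invFun := joinedFlip
  left_inv := joinedFlip_joinedFlip
  right_inv := joinedFlip_joinedFlip

theorem turnPerm_pow (l r : BinaryTree Unit) : turnPerm l r ^ 3 = 1 :=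
  Equiv.ext joinedTurn_joinedTurn_joinedTurn

theorem flipPerm_pow (l r : BinaryTree Unit) : flipPerm l r ^ 2 = 1 :=
  Equiv.ext joinedFlip_joinedFlip

end TreeFlag

/-! ### Branches embedded in a set with an action, and recovery of their shapes -/

section Embedding

open TreeFlag

variable {Ω : Type*} [MulAction PSL(2, ℤ) Ω]

/-- An embedding of a rooted tree into a set with an action of the modular group. -/
structure IsBranchEmbedding {t : BinaryTree Unit} (φ : TreeFlag t → Ω) : Prop where
  injective : Function.Injective φ
  turn : ∀ f, projX • φ f = φ (turn f)
  flip : ∀ f, f ≠ here 0 → projY • φ f = φ (flip f)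

namespace IsBranchEmbedding

variable {u : Unit} {l r t : BinaryTree Unit}

theorem left {φ : TreeFlag (node u l r) → Ω} (h : IsBranchEmbedding φ) :
    IsBranchEmbedding fun f => φ (left f) where
  injective f g hfg := by simpa using h.injective hfg
  turn f := h.turn _
  flip f hf := by
    rw [h.flip _ (by simp)]
    simp [TreeFlag.flip, hf]

theorem right {φ : TreeFlag (node u l r) → Ω} (h : IsBranchEmbedding φ) :
    IsBranchEmbedding fun f => φ (right f) where
  injective f g hfg := by simpa using h.injective hfg
  turn f := h.turn _
  flip f hf := by
    rw [h.flip _ (by simp)]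
    simp [TreeFlag.flip, hf]

theorem turn_inv {φ : TreeFlag t → Ω} (h : IsBranchEmbedding φ) :
    projX⁻¹ • φ (here 0) = φ (here 2) := by
  rw [← projX_smul_smul, h.turn, h.turn]
  rfl

theorem left_root {φ : TreeFlag (node u l r) → Ω} (h : IsBranchEmbedding φ) :
    projY • projX⁻¹ • φ (here 0) = φ (.left (here 0)) := by
  rw [h.turn_inv, h.flip _ (by simp)]
  simp [TreeFlag.flip]

theorem right_root {φ : TreeFlag (node u l r) → Ω} (h : IsBranchEmbedding φ) :
    projY • projX • φ (here 0) = φ (.right (here 0)) := by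
  rw [h.turn, h.flip _ (by simp [TreeFlag.turn])]
  simp [TreeFlag.flip, TreeFlag.turn]

theorem mem_orbit {φ : TreeFlag t → Ω} (h : IsBranchEmbedding φ) (f : TreeFlag t) :
    φ f ∈ MulAction.orbit PSL(2, ℤ) (φ (here 0)) := by
  induction f with
  | here i =>
    obtain rfl | rfl | rfl : i = 0 ∨ i = 1 ∨ i = 2 := by omega
    · exact MulAction.mem_orbit_self _
    · exact ⟨projX, h.turn _⟩
    · exact ⟨projX⁻¹, h.turn_inv⟩
  | left f ih =>
    obtain ⟨g, hg⟩ := ih h.left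
    exact ⟨g * (projY * projX⁻¹), by
      change (g * (projY * projX⁻¹)) • _ = _
      rw [mul_smul, mul_smul, h.left_root]
      exact hg⟩
  | right f ih =>
    obtain ⟨g, hg⟩ := ih h.right
    exact ⟨g * (projY * projX), by
      change (g * (projY * projX)) • _ = _
      rw [mul_smul, mul_smul, h.right_root]
      exact hg⟩

/-- An entry is a path from the root to a leaf, around its loop and back; the path never flips the
root half-edge, so it can be followed inside the image of `φ`. -/
theorem branch_smul {φ : TreeFlag t → Ω} (h : IsBranchEmbedding φ) (i : Fin t.numLeaves) :
    branch projX projY t i • φ (here 0) = φ (here 0) := by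
  induction t with
  | nil =>
    change (projX * (projX * projY) * projX⁻¹) • φ (here 0) = φ (here 0)
    rw [mul_smul, mul_smul, mul_smul, h.turn_inv, h.flip _ (by simp), h.turn, h.turn]
    rfl
  | node _ l r hl hr =>
    change Fin (l.numLeaves + r.numLeaves) at i
    induction i using Fin.addCases with
    | left i =>
      simp only [branch, Fin.append_left, conjFactorization]
      rw [mul_smul, mul_smul, smul_eq_iff_eq_inv_smul, mul_inv_rev, projY_inv, mul_smul,
        h.left_root]
      exact hl h.left i
    | right i =>
      simp only [branch, Fin.append_right, conjFactorization]
      rw [mul_smul, mul_smul, smul_eq_iff_eq_inv_smul, mul_inv_rev, projY_inv, inv_inv, mul_smul,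
        h.right_root]
      exact hr h.right i

end IsBranchEmbedding

/-- The shape `t` of a branch can be read off from the subgroup `H`, where `g` is a path from the
base point to the root of the branch. -/
def HasBranch (H : Subgroup PSL(2, ℤ)) : PSL(2, ℤ) → BinaryTree Unit → Prop
  | g, nil => g * (projX * (projX * projY) * projX⁻¹) * g⁻¹ ∈ H
  | g, node _ l r => g * (projX * (projX * projY) * projX⁻¹) * g⁻¹ ∉ H ∧
      HasBranch H (g * (projX * projY)) l ∧ HasBranch H (g * (projX⁻¹ * projY)) r

/-- Whether the loop word at `g` lies in `H` decides between a leaf and a node, and the recursion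
then continues at two determined paths. -/
theorem HasBranch.unique {H : Subgroup PSL(2, ℤ)} {g : PSL(2, ℤ)} {t t' : BinaryTree Unit}
    (h : HasBranch H g t) (h' : HasBranch H g t') : t = t' := by
  induction t generalizing g t' with
  | nil =>
    cases t' with
    | nil => rfl
    | node _ l r => exact absurd h h'.1
  | node _ l r hl hr =>
    cases t' with
    | nil => exact absurd h' h.1
    | node _ l' r' => rw [hl h.2.1 h'.2.1, hr h.2.2 h'.2.2]

theorem IsBranchEmbedding.hasBranch {H : Subgroup PSL(2, ℤ)} {P : Ω}
    (hH : H ≤ MulAction.stabilizer PSL(2, ℤ) P) {t : BinaryTree Unit} {φ : TreeFlag t → Ω}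
    (h : IsBranchEmbedding φ) {g : PSL(2, ℤ)} (hg : P = g • φ (here 0))
    (hb : ∀ i, g * branch projX projY t i * g⁻¹ ∈ H) : HasBranch H g t := by
  induction t generalizing g with
  | nil => exact hb ⟨0, by simp⟩
  | node _ l r hl hr =>
    refine ⟨fun hc => ?_, hl h.left ?_ fun i => ?_, hr h.right ?_ fun i => ?_⟩
    -- At a node the loop word would carry the root flag to the flag `here 2` of the left subtree,
    -- against injectivity.
    · have := hH hc
      rw [MulAction.mem_stabilizer_iff, hg, mul_smul, mul_smul, inv_smul_smul, smul_left_cancel_iff,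
        mul_smul, mul_smul, mul_smul, h.left_root, h.turn, h.turn] at this
      simpa [TreeFlag.turn] using h.injective this
    · rw [hg, ← h.left_root, mul_smul, mul_smul, projY_smul_smul, smul_inv_smul]
    · have := hb (Fin.castAdd _ i)
      simpa [branch, conjFactorization, mul_assoc] using this
    · rw [hg, ← h.right_root, mul_smul, mul_smul, projY_smul_smul, inv_smul_smul]
    · have := hb (Fin.natAdd _ i)
      simpa [branch, conjFactorization, mul_assoc] using this

end Embedding

/-- The joined tree as a set with an action of the modular group. -/
theorem exists_action (l r : BinaryTree Unit) :
    ∃ _ : MulAction PSL(2, ℤ) (TreeFlag l ⊕ TreeFlag r),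
      (∀ f : TreeFlag l ⊕ TreeFlag r, projX • f = TreeFlag.joinedTurn f) ∧
      ∀ f : TreeFlag l ⊕ TreeFlag r, projY • f = TreeFlag.joinedFlip f := by
  obtain ⟨ψ, hX, hY⟩ := exists_modularHom (TreeFlag.turnPerm_pow l r) (TreeFlag.flipPerm_pow l r)
  refine ⟨MulAction.compHom _ ψ, fun f => ?_, fun f => ?_⟩
  · change ψ projX f = _
    rw [hX]
    rfl
  · change ψ projY f = _
    rw [hY]
    rfl

/-- In the action on flags the monodromy group fixes the root flag `P` of `l`, whose orbit consists
of all `6 * (l.numLeaves + r.numLeaves) - 6` flags. So its index is a nonzero multiple of this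
number and, by the covering bound, equal to it. The last clause says that the base point is not on a
loop. -/
theorem joinedGroup_properties (l r : BinaryTree Unit) :
    (joinedGroup l r).index + 6 = 6 * (l.numLeaves + r.numLeaves) ∧
      HasBranch (joinedGroup l r) 1 l ∧ HasBranch (joinedGroup l r) projY r ∧
      projX⁻¹ * projY ∉ joinedGroup l r := by
  obtain ⟨_, hX, hY⟩ := exists_action l r
  let P : TreeFlag l ⊕ TreeFlag r := Sum.inl (.here 0)
  have hYP : projY • P = Sum.inr (.here 0) := by
    rw [hY]
    simp [P, TreeFlag.joinedFlip]
  have hl : IsBranchEmbedding (Sum.inl : TreeFlag l → TreeFlag l ⊕ TreeFlag r) :=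
    ⟨Sum.inl_injective, fun f => hX _, fun f hf => by rw [hY]; simp [TreeFlag.joinedFlip, hf]⟩
  have hr : IsBranchEmbedding (Sum.inr : TreeFlag r → TreeFlag l ⊕ TreeFlag r) :=
    ⟨Sum.inr_injective, fun f => hX _, fun f hf => by rw [hY]; simp [TreeFlag.joinedFlip, hf]⟩
  have hstab : joinedGroup l r ≤ MulAction.stabilizer PSL(2, ℤ) P := by
    refine (Subgroup.closure_le _).2 ?_
    rintro _ ⟨i, rfl⟩
    rw [SetLike.mem_coe, MulAction.mem_stabilizer_iff]
    induction i using Fin.addCases with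
    | left i =>
      simp only [joined, Fin.append_left]
      exact hl.branch_smul i
    | right i =>
      simp only [joined, Fin.append_right, conjFactorization]
      rw [mul_smul, mul_smul, smul_eq_iff_eq_inv_smul, projY_inv, hYP]
      exact hr.branch_smul i
  have horbit : MulAction.orbit PSL(2, ℤ) P = Set.univ := by
    rw [Set.eq_univ_iff_forall]
    rintro (f | f)
    · exact hl.mem_orbit f
    · obtain ⟨g, hg⟩ := hr.mem_orbit f
      exact ⟨g * projY, by
        change (g * projY) • _ = _
        rw [mul_smul, hYP]
        exact hg⟩
  refine ⟨?_, ?_, ?_, fun h => ?_⟩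
  · obtain ⟨h0, h1⟩ := index_joinedGroup_le l r
    have h2 := Nat.le_of_dvd (Nat.pos_of_ne_zero h0) (Subgroup.index_dvd_of_le hstab)
    rw [MulAction.index_stabilizer, horbit, Set.ncard_univ, Nat.card_sum] at h2
    have h3 := TreeFlag.card l
    have h4 := TreeFlag.card r
    omega
  · refine hl.hasBranch hstab (one_smul _ _).symm fun i => ?_
    rw [one_mul, inv_one, mul_one]
    exact branch_mem_joinedGroup_left l r i
  · refine hr.hasBranch hstab ?_ fun i => branch_mem_joinedGroup_right l r i
    rw [← hYP, projY_smul_smul]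
  · have := hstab h
    rw [MulAction.mem_stabilizer_iff, mul_smul, hYP, hr.turn_inv] at this
    exact Sum.inr_ne_inl this

/-! ### The quadratic form of a concatenation and of a conjugate -/

section Form

open Matrix

variable {r s : ℕ}

theorem chi_apply (m : Factorization SL(2, ℤ) r) (x : Fin r → Fin 2 → ℤ) :
    chi m x = ∑ i, ((m i : Matrix (Fin 2) (Fin 2) ℤ) *ᵥ x i - x i) := by
  simp [chi]

theorem chi_append (m : Factorization SL(2, ℤ) r) (m' : Factorization SL(2, ℤ) s)
    (x : Fin (r + s) → Fin 2 → ℤ) :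
    chi (Fin.append m m' : Factorization SL(2, ℤ) (r + s)) x =
      chi m (fun i => x (Fin.castAdd s i)) + chi m' (fun i => x (Fin.natAdd r i)) := by
  simp [chi_apply, Fin.sum_univ_add]

theorem sum_Ioi_append (F : Fin (r + s) → Fin (r + s) → ℤ) :
    ∑ i, ∑ j ∈ Finset.Ioi i, F i j =
      ∑ i, ∑ j ∈ Finset.Ioi i, F (Fin.castAdd s i) (Fin.castAdd s j) +
      ∑ i, ∑ j ∈ Finset.Ioi i, F (Fin.natAdd r i) (Fin.natAdd r j) +
      ∑ i, ∑ j, F (Fin.castAdd s i) (Fin.natAdd r j) := by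
  have h : ∀ (n : ℕ) (E : Fin n → Fin n → ℤ), ∑ i, ∑ j ∈ Finset.Ioi i, E i j =
      ∑ i, ∑ j, if i < j then E i j else 0 := fun n E => by
    refine Finset.sum_congr rfl fun i _ => ?_
    rw [← Finset.sum_filter]
    congr 1
    ext j
    simp
  rw [h, h, h, Fin.sum_univ_add]
  simp only [Fin.sum_univ_add, Finset.sum_add_distrib]
  have h1 : ∀ (i : Fin r) (j : Fin s), Fin.castAdd s i < Fin.natAdd r j := fun i j => by
    simp only [Fin.lt_def, Fin.val_castAdd, Fin.val_natAdd]
    omega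
  have h2 : ∀ (i : Fin r) (j : Fin s), ¬ Fin.natAdd r j < Fin.castAdd s i := fun i j =>
    (h1 i j).le.not_gt
  have h3 : ∀ (i j : Fin r), Fin.castAdd s i < Fin.castAdd s j ↔ i < j := fun i j => by
    simp only [Fin.lt_def, Fin.val_castAdd]
  have h4 : ∀ (i j : Fin s), Fin.natAdd r i < Fin.natAdd r j ↔ i < j := fun i j => by
    simp only [Fin.lt_def, Fin.val_natAdd]
    omega
  simp only [h1, h2, h3, h4, if_true, if_false, Finset.sum_const_zero]
  ring

theorem sum_skew_sum {ι κ : Type*} [Fintype ι] [Fintype κ] (c : ι → Fin 2 → ℤ)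
    (d : κ → Fin 2 → ℤ) : ∑ i, ∑ j, skew (c i) (d j) = skew (∑ i, c i) (∑ j, d j) := by
  simp only [skew, Finset.sum_sub_distrib, Finset.sum_apply, Finset.sum_mul_sum]

theorem skew_mulVec (g : SL(2, ℤ)) (x y : Fin 2 → ℤ) :
    skew ((g : Matrix (Fin 2) (Fin 2) ℤ) *ᵥ x) ((g : Matrix (Fin 2) (Fin 2) ℤ) *ᵥ y) =
      skew x y := by
  have h := g.det_coe
  rw [Matrix.det_fin_two] at h
  simp only [skew, Matrix.mulVec, dotProduct, Fin.sum_univ_two]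
  linear_combination (x 0 * y 1 - x 1 * y 0) * h

/-- The mixed terms sum to a product of the two values of `χ`, so two blocks interact only through
`χ`. This makes an induction on the tree possible. -/
theorem quad_append (m : Factorization SL(2, ℤ) r) (m' : Factorization SL(2, ℤ) s)
    (x : Fin (r + s) → Fin 2 → ℤ) :
    quad (Fin.append m m' : Factorization SL(2, ℤ) (r + s)) x =
      quad m (fun i => x (Fin.castAdd s i)) + quad m' (fun i => x (Fin.natAdd r i)) +
      skew (chi m (fun i => x (Fin.castAdd s i))) (chi m' (fun i => x (Fin.natAdd r i))) := by
  rw [quad, sum_Ioi_append, Fin.sum_univ_add]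
  simp only [Fin.append_left, Fin.append_right]
  rw [sum_skew_sum, ← chi_apply, ← chi_apply, quad, quad]
  ring

theorem mulVec_conj (g h : SL(2, ℤ)) (x : Fin 2 → ℤ) :
    ((g * h * g⁻¹ : SL(2, ℤ)) : Matrix (Fin 2) (Fin 2) ℤ) *ᵥ x =
      (g : Matrix (Fin 2) (Fin 2) ℤ) *ᵥ ((h : Matrix (Fin 2) (Fin 2) ℤ) *ᵥ
        (((g⁻¹ : SL(2, ℤ)) : Matrix (Fin 2) (Fin 2) ℤ) *ᵥ x)) := by
  simp only [Matrix.SpecialLinearGroup.coe_mul, Matrix.mulVec_mulVec, Matrix.mul_assoc]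

theorem mulVec_inv_mulVec (g : SL(2, ℤ)) (x : Fin 2 → ℤ) :
    (g : Matrix (Fin 2) (Fin 2) ℤ) *ᵥ
      (((g⁻¹ : SL(2, ℤ)) : Matrix (Fin 2) (Fin 2) ℤ) *ᵥ x) = x := by
  rw [Matrix.mulVec_mulVec, ← Matrix.SpecialLinearGroup.coe_mul, mul_inv_cancel,
    Matrix.SpecialLinearGroup.coe_one, Matrix.one_mulVec]

theorem inv_mulVec_mulVec (g : SL(2, ℤ)) (x : Fin 2 → ℤ) :
    ((g⁻¹ : SL(2, ℤ)) : Matrix (Fin 2) (Fin 2) ℤ) *ᵥ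
      ((g : Matrix (Fin 2) (Fin 2) ℤ) *ᵥ x) = x := by
  simpa using mulVec_inv_mulVec g⁻¹ x

/-- The diagonal action of a matrix on `⨁ᵢ ℤ²`. -/
def diagMul (g : SL(2, ℤ)) (r : ℕ) : (Fin r → Fin 2 → ℤ) →ₗ[ℤ] (Fin r → Fin 2 → ℤ) :=
  LinearMap.pi fun i => (g : Matrix (Fin 2) (Fin 2) ℤ).mulVecLin.comp (LinearMap.proj i)

theorem diagMul_apply (g : SL(2, ℤ)) (x : Fin r → Fin 2 → ℤ) (i : Fin r) :
    diagMul g r x i = (g : Matrix (Fin 2) (Fin 2) ℤ) *ᵥ x i := rfl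

theorem diagMul_inv_diagMul (g : SL(2, ℤ)) (x : Fin r → Fin 2 → ℤ) :
    diagMul g⁻¹ r (diagMul g r x) = x :=
  funext fun i => inv_mulVec_mulVec g (x i)

theorem mulVec_conj_sub (g h : SL(2, ℤ)) (x : Fin 2 → ℤ) :
    ((g * h * g⁻¹ : SL(2, ℤ)) : Matrix (Fin 2) (Fin 2) ℤ) *ᵥ x - x =
      (g : Matrix (Fin 2) (Fin 2) ℤ) *ᵥ ((h : Matrix (Fin 2) (Fin 2) ℤ) *ᵥ
        (((g⁻¹ : SL(2, ℤ)) : Matrix (Fin 2) (Fin 2) ℤ) *ᵥ x) -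
        ((g⁻¹ : SL(2, ℤ)) : Matrix (Fin 2) (Fin 2) ℤ) *ᵥ x) := by
  rw [Matrix.mulVec_sub, mulVec_inv_mulVec, mulVec_conj]

theorem chi_conj (g : SL(2, ℤ)) (m : Factorization SL(2, ℤ) r) (x : Fin r → Fin 2 → ℤ) :
    chi (conjFactorization g m) x =
      (g : Matrix (Fin 2) (Fin 2) ℤ) *ᵥ chi m (diagMul g⁻¹ r x) := by
  rw [chi_apply, chi_apply, Matrix.mulVec_sum]
  exact Finset.sum_congr rfl fun i _ => mulVec_conj_sub g (m i) (x i)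

theorem quad_conj (g : SL(2, ℤ)) (m : Factorization SL(2, ℤ) r) (x : Fin r → Fin 2 → ℤ) :
    quad (conjFactorization g m) x = quad m (diagMul g⁻¹ r x) := by
  simp only [quad, conjFactorization, mulVec_conj_sub, skew_mulVec, diagMul_apply]
  congr 2
  refine Finset.sum_congr rfl fun i _ => ?_
  rw [mulVec_conj, ← skew_mulVec g⁻¹, inv_mulVec_mulVec]

end Form

/-! ### The quadratic form of a tree -/

section TreeForm

open Matrix

/-- The projection of `⨁ᵢ ℤ²` to the first summands. -/
def restrictLeft (r s : ℕ) : (Fin (r + s) → Fin 2 → ℤ) →ₗ[ℤ] (Fin r → Fin 2 → ℤ) :=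
  LinearMap.funLeft ℤ _ (Fin.castAdd s)

/-- The projection of `⨁ᵢ ℤ²` to the last summands. -/
def restrictRight (r s : ℕ) : (Fin (r + s) → Fin 2 → ℤ) →ₗ[ℤ] (Fin s → Fin 2 → ℤ) :=
  LinearMap.funLeft ℤ _ (Fin.natAdd r)

theorem restrictLeft_append {r s : ℕ} (x : Fin r → Fin 2 → ℤ) (y : Fin s → Fin 2 → ℤ) :
    restrictLeft r s (Fin.append x y) = x := by
  funext i
  simp [restrictLeft, LinearMap.funLeft_apply]

theorem restrictRight_append {r s : ℕ} (x : Fin r → Fin 2 → ℤ) (y : Fin s → Fin 2 → ℤ) :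
    restrictRight r s (Fin.append x y) = y := by
  funext i
  simp [restrictRight, LinearMap.funLeft_apply]

/-- The sign `(-1) ^ n`. -/
def leafSign (n : ℕ) : ℤ := (-1) ^ n

theorem leafSign_eq (n : ℕ) :
    (leafSign n = 1 ∧ n % 2 = 0) ∨ (leafSign n = -1 ∧ n % 2 = 1) := by
  rcases Nat.even_or_odd n with h | h
  · exact Or.inl ⟨h.neg_one_pow, Nat.even_iff.1 h⟩
  · exact Or.inr ⟨h.neg_one_pow, Nat.odd_iff.1 h⟩

theorem leafSign_mul_self (n : ℕ) : leafSign n * leafSign n = 1 := by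
  rcases leafSign_eq n with h | h <;> simp [h.1]

theorem abs_leafSign (n : ℕ) : |leafSign n| = 1 := by
  rcases leafSign_eq n with h | h <;> simp [h.1]

/-- The form of `m` is the difference of a hyperbolic plane, on which `χ` takes its values, and of a
sum of squares; the image of the coordinate map is cut out by one linear equation with
coefficients `±1` and `±3`. -/
def HasBranchForm {n : ℕ} (m : Factorization SL(2, ℤ) n) : Prop :=
  ∃ (ι : Type) (_ : Fintype ι) (u : (Fin n → Fin 2 → ℤ) →ₗ[ℤ] (ι → ℤ)) (w : ι → ℤ),
    Fintype.card ι + 1 = n ∧ (∀ i, |w i| = 1 ∨ |w i| = 3) ∧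
    (∑ i, if |w i| = 3 then 1 else 0) = n / 2 ∧
    (∀ x, quad m x = chi m x 0 * chi m x 1 - ∑ i, u x i ^ 2) ∧
    ∀ (a : ι → ℤ) (z : Fin 2 → ℤ), (∃ x, u x = a ∧ chi m x = z) ↔
      ∑ i, w i * a i + z 0 + leafSign n * z 1 = 0

/-- With `d = x 0 1 - x 0 0`, both coordinates of `χ` equal `d` and `q` equals `d ^ 2`: there are no
extra squares, and the relation is `z 0 - z 1 = 0`. -/
theorem hasBranchForm_leaf :
    HasBranchForm fun _ : Fin 1 => matX * (matX * matY) * matX⁻¹ := by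
  have hm : ((matX * (matX * matY) * matX⁻¹ : SL(2, ℤ)) : Matrix (Fin 2) (Fin 2) ℤ) =
      !![0, 1; -1, 2] := by decide
  have hchi : ∀ x : Fin 1 → Fin 2 → ℤ, chi (fun _ : Fin 1 => matX * (matX * matY) * matX⁻¹) x =
      ![x 0 1 - x 0 0, x 0 1 - x 0 0] := fun x => by
    rw [chi_apply, Fin.sum_univ_one, hm]
    ext i
    fin_cases i <;> simp [dotProduct, Fin.sum_univ_two]
    ring
  have hquad : ∀ x : Fin 1 → Fin 2 → ℤ, quad (fun _ : Fin 1 => matX * (matX * matY) * matX⁻¹) x =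
      (x 0 1 - x 0 0) * (x 0 1 - x 0 0) := fun x => by
    have h1 : quad (fun _ : Fin 1 => matX * (matX * matY) * matX⁻¹) x = -skew (x 0)
        (((matX * (matX * matY) * matX⁻¹ : SL(2, ℤ)) : Matrix (Fin 2) (Fin 2) ℤ) *ᵥ x 0) := by
      rw [quad, Fin.sum_univ_one, Fin.sum_univ_one, show Finset.Ioi (0 : Fin 1) = ∅ by decide,
        Finset.sum_empty, add_zero]
    rw [h1, hm]
    simp [skew, Matrix.mulVec, dotProduct, Fin.sum_univ_two]
    ring
  refine ⟨Empty, inferInstance, 0, fun _ => 0, by simp, by simp, by simp, fun x => ?_,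
    fun a z => ⟨?_, fun h => ⟨fun _ => ![0, z 0], Subsingleton.elim _ _, ?_⟩⟩⟩
  · rw [hquad, hchi]
    simp
  · rintro ⟨x, -, rfl⟩
    rw [hchi]
    simp [leafSign]
  · have h' : z 1 = z 0 := by
      simp [leafSign] at h
      omega
    rw [hchi]
    ext i
    fin_cases i <;> simp [h']

/-- The two old hyperbolic terms plus the interaction term equal the new hyperbolic term minus one
square. The new relation is the left one minus `leafSign r` times the right one. -/
theorem HasBranchForm.append {r s : ℕ} {m : Factorization SL(2, ℤ) r}
    {m' : Factorization SL(2, ℤ) s} (hl : HasBranchForm m) (hr : HasBranchForm m') :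
    HasBranchForm (Fin.append (conjFactorization (matX * matY) m)
      (conjFactorization (matX⁻¹ * matY) m') : Factorization SL(2, ℤ) (r + s)) := by
  obtain ⟨ι, _, u, w, hcard, hw, hcount, hquad, hrel⟩ := hl
  obtain ⟨ι', _, u', w', hcard', hw', hcount', hquad', hrel'⟩ := hr
  let p : (Fin (r + s) → Fin 2 → ℤ) →ₗ[ℤ] (Fin r → Fin 2 → ℤ) :=
    (diagMul (matX * matY)⁻¹ _).comp (restrictLeft _ _)
  let p' : (Fin (r + s) → Fin 2 → ℤ) →ₗ[ℤ] (Fin s → Fin 2 → ℤ) :=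
    (diagMul (matX⁻¹ * matY)⁻¹ _).comp (restrictRight _ _)
  -- The coordinate `none` is the linear form whose square is split off.
  let U : (Fin (r + s) → Fin 2 → ℤ) →ₗ[ℤ] (Option (ι ⊕ ι') → ℤ) :=
    LinearMap.pi fun o => o.elim
      ((LinearMap.proj 1).comp ((chi m).comp p) -
        (LinearMap.proj 0).comp ((chi m').comp p'))
      (Sum.elim (fun i => (LinearMap.proj i).comp (u.comp p))
        fun i => (LinearMap.proj i).comp (u'.comp p'))
  have hU0 : ∀ x, U x none = chi m (p x) 1 - chi m' (p' x) 0 :=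
    fun x => rfl
  have hU1 : ∀ x i, U x (some (Sum.inl i)) = u (p x) i := fun x i => rfl
  have hU2 : ∀ x i, U x (some (Sum.inr i)) = u' (p' x) i := fun x i => rfl
  have hg : ((matX * matY : SL(2, ℤ)) : Matrix (Fin 2) (Fin 2) ℤ) = !![1, 1; 0, 1] := by decide
  have hh : ((matX⁻¹ * matY : SL(2, ℤ)) : Matrix (Fin 2) (Fin 2) ℤ) = !![-1, 0; -1, -1] := by
    decide
  have hg' : ∀ X : Fin 2 → ℤ, !![1, 1; 0, 1] *ᵥ X = ![X 0 + X 1, X 1] := fun X => by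
    ext i
    fin_cases i <;> simp [Matrix.mulVec, dotProduct, Fin.sum_univ_two]
  have hh' : ∀ Y : Fin 2 → ℤ, !![-1, 0; -1, -1] *ᵥ Y = ![-Y 0, -Y 0 - Y 1] := fun Y => by
    ext i
    fin_cases i <;> simp [Matrix.mulVec, dotProduct, Fin.sum_univ_two]
    ring
  have hchi : ∀ x : Fin (r + s) → Fin 2 → ℤ,
      chi (Fin.append (conjFactorization (matX * matY) m)
        (conjFactorization (matX⁻¹ * matY) m') : Factorization SL(2, ℤ) (r + s)) x =
      ![chi m (p x) 0 + chi m (p x) 1,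
        chi m (p x) 1] +
      ![-chi m' (p' x) 0,
        -chi m' (p' x) 0 - chi m' (p' x) 1] := fun x => by
    rw [chi_append, chi_conj, chi_conj, hg, hh, hg', hh']
    rfl
  have hquadn : ∀ x : Fin (r + s) → Fin 2 → ℤ,
      quad (Fin.append (conjFactorization (matX * matY) m)
        (conjFactorization (matX⁻¹ * matY) m') : Factorization SL(2, ℤ) (r + s)) x =
      quad m (p x) + quad m' (p' x) +
      skew ![chi m (p x) 0 + chi m (p x) 1,
        chi m (p x) 1]
        ![-chi m' (p' x) 0,
        -chi m' (p' x) 0 - chi m' (p' x) 1] := fun x => by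
    rw [quad_append, quad_conj, quad_conj, chi_conj, chi_conj, hg, hh, hg', hh']
    rfl
  -- The new coefficient is `-3` if `r` and `s` are both odd and `±1` otherwise. This is exactly the
  -- carry in `r / 2 + s / 2` versus `(r + s) / 2`.
  let W : Option (ι ⊕ ι') → ℤ := fun o => o.elim (leafSign r - 1 - leafSign r * leafSign s)
    (Sum.elim w fun i => -leafSign r * w' i)
  have hsign : leafSign (r + s) = leafSign r * leafSign s := by
    simp [leafSign, pow_add]
  have hWr : ∀ i, |W (some (Sum.inr i))| = |w' i| := fun i => by
    change |-leafSign r * w' i| = _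
    rw [abs_mul, abs_neg, abs_leafSign, one_mul]
  refine ⟨Option (ι ⊕ ι'), inferInstance, U, W, ?_, ?_, ?_, fun x => ?_, fun a z => ?_⟩
  · simp only [Fintype.card_option, Fintype.card_sum]
    omega
  · rintro (_ | i | i)
    · change |leafSign r - 1 - leafSign r * leafSign s| = 1 ∨
        |leafSign r - 1 - leafSign r * leafSign s| = 3
      rcases leafSign_eq r with ⟨h, -⟩ | ⟨h, -⟩ <;> rcases leafSign_eq s with ⟨h', -⟩ | ⟨h', -⟩ <;>
        simp [h, h']
    · exact hw i
    · rw [hWr]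
      exact hw' i
  · rw [Fintype.sum_option, Fintype.sum_sum_type]
    simp only [hWr]
    change (if |leafSign r - 1 - leafSign r * leafSign s| = 3 then 1 else 0) +
      ((∑ i, if |w i| = 3 then 1 else 0) + _) = _
    rw [hcount, hcount']
    rcases leafSign_eq r with ⟨h, hp⟩ | ⟨h, hp⟩ <;>
      rcases leafSign_eq s with ⟨h', hp'⟩ | ⟨h', hp'⟩ <;> simp [h, h'] <;> omega
  · have h := hquadn x
    have h' := hchi x
    rw [h, h', Fintype.sum_option, Fintype.sum_sum_type, hU0, hquad, hquad']
    simp only [hU1, hU2]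
    simp only [skew, Pi.add_apply, Matrix.cons_val_zero, Matrix.cons_val_one]
    ring
  · rw [Fintype.sum_option, Fintype.sum_sum_type, hsign]
    simp only [W, Option.elim_none, Option.elim_some, Sum.elim_inl, Sum.elim_inr]
    have hs : ∑ i, -leafSign r * w' i * a (some (Sum.inr i)) =
        -leafSign r * ∑ i, w' i * a (some (Sum.inr i)) := by
      rw [Finset.mul_sum]
      exact Finset.sum_congr rfl fun i _ => by ring
    rw [hs]
    constructor
    · rintro ⟨x, rfl, rfl⟩
      have h := (hrel (u (p x)) (chi m (p x))).1 ⟨_, rfl, rfl⟩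
      have h' := (hrel' (u' (p' x)) (chi m' (p' x))).1 ⟨_, rfl, rfl⟩
      have hc := hchi x
      rw [hc, hU0]
      simp only [hU1, hU2, Pi.add_apply, Matrix.cons_val_zero, Matrix.cons_val_one]
      linear_combination h - leafSign r * h'
    · intro hrel0
      -- The prescribed `z` and `a none` determine three of the four old values of `χ` in terms of
      -- the first coordinate on the right. The right relation fixes that one, and the left relation
      -- is then the hypothesis.
      obtain ⟨x₁, hx₁, hc₁⟩ := (hrel (fun i => a (some (Sum.inl i)))
        ![z 0 - a none, -(∑ i, w' i * a (some (Sum.inr i))) - leafSign s * (a none - z 1) +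
          a none]).2 (by
          simp only [Matrix.cons_val_zero, Matrix.cons_val_one]
          linear_combination hrel0)
      obtain ⟨x₂, hx₂, hc₂⟩ := (hrel' (fun i => a (some (Sum.inr i)))
        ![-(∑ i, w' i * a (some (Sum.inr i))) - leafSign s * (a none - z 1), a none - z 1]).2 (by
          simp only [Matrix.cons_val_zero, Matrix.cons_val_one]
          ring)
      let x : Fin (r + s) → Fin 2 → ℤ :=
        Fin.append (diagMul (matX * matY) _ x₁) (diagMul (matX⁻¹ * matY) _ x₂)
      have hp : p x = x₁ := by
        change diagMul _ _ (restrictLeft _ _ x) = _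
        rw [restrictLeft_append, diagMul_inv_diagMul]
      have hp' : p' x = x₂ := by
        change diagMul _ _ (restrictRight _ _ x) = _
        rw [restrictRight_append, diagMul_inv_diagMul]
      refine ⟨x, ?_, ?_⟩
      · funext o
        rcases o with _ | i | i
        · rw [hU0, hp, hp', hc₁, hc₂]
          simp
        · rw [hU1, hp, hx₁]
        · rw [hU2, hp', hx₂]
      · have hc := hchi x
        rw [hc, hp, hp', hc₁, hc₂]
        ext i
        fin_cases i
        · simp
          ring
        · simp
          ring

theorem hasBranchForm_branch (t : BinaryTree Unit) : HasBranchForm (branch matX matY t) := by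
  induction t with
  | nil => exact hasBranchForm_leaf
  | node _ l r hl hr => exact hl.append hr

end TreeForm

/-! ### The transcendental lattice of a tree -/

section ClosedForm

open Matrix

/-- The vectors of the standard lattice in `ℤᵏ`: the root lattice of type `D` if `k` is even, and
the orthogonal complement of `(3, …, 3, 1, …, 1)` if `k` is odd. -/
def IsStandardVector (k : ℕ) (a : Fin k → ℤ) : Prop :=
  if Even k then Even (∑ i, a i)
  else ∑ i : Fin k, (if (i : ℕ) < (k + 1) / 2 then 3 else 1) * a i = 0

/-- The restriction of the form of `m` to the kernel of `χ` factors through the standard lattice. -/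
def HasStandardForm {r : ℕ} (m : Factorization SL(2, ℤ) r) (k : ℕ) : Prop :=
  ∃ f : (Fin r → Fin 2 → ℤ) →ₗ[ℤ] (Fin k → ℤ),
    (∀ x, chi m x = 0 → quad m x = -∑ i, f x i ^ 2) ∧
    ∀ a, (∃ x, chi m x = 0 ∧ f x = a) ↔ IsStandardVector k a

theorem HasStandardForm.conj {r k : ℕ} {m : Factorization SL(2, ℤ) r} (h : HasStandardForm m k)
    (g : SL(2, ℤ)) : HasStandardForm (conjFactorization g m) k := by
  obtain ⟨f, hf, hrange⟩ := h
  have hker : ∀ x, chi (conjFactorization g m) x = 0 ↔ chi m (diagMul g⁻¹ r x) = 0 := fun x => by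
    rw [chi_conj]
    refine ⟨fun h => ?_, fun h => by rw [h, Matrix.mulVec_zero]⟩
    rw [← inv_mulVec_mulVec g (chi m _), h, Matrix.mulVec_zero]
  refine ⟨f.comp (diagMul g⁻¹ r), fun x hx => ?_, fun a => ?_⟩
  · rw [quad_conj, hf _ ((hker x).1 hx)]
    rfl
  · rw [← hrange]
    constructor
    · rintro ⟨x, hx, rfl⟩
      exact ⟨_, (hker x).1 hx, rfl⟩
    · rintro ⟨x, hx, rfl⟩
      refine ⟨diagMul g r x, ?_, ?_⟩
      · rw [hker, diagMul_inv_diagMul, hx]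
      · rw [LinearMap.comp_apply, diagMul_inv_diagMul]

/-- Factorizations with the same standard form have isometric transcendental lattices. -/
theorem HasStandardForm.sameTranscendentalLattice {r s k : ℕ} {m : Factorization SL(2, ℤ) r}
    {m' : Factorization SL(2, ℤ) s} (h : HasStandardForm m k) (h' : HasStandardForm m' k) :
    SameTranscendentalLattice m m' := by
  obtain ⟨f, hf, hrange⟩ := h
  obtain ⟨f', hf', hrange'⟩ := h'
  -- By definiteness, testing a radical vector against `y = 0` already kills all its coordinates.
  -- The lattice is therefore the range of the coordinate map.
  have key : ∀ {n : ℕ} {μ : Factorization SL(2, ℤ) n} (φ : (Fin n → Fin 2 → ℤ) →ₗ[ℤ] (Fin k → ℤ)),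
      (∀ x, chi μ x = 0 → quad μ x = -∑ i, φ x i ^ 2) →
      LinearMap.ker (φ.comp (chiKer μ).subtype) = radical μ := by
    intro n μ φ hφ
    ext x
    rw [LinearMap.mem_ker, mem_radical]
    change φ x = 0 ↔ _
    have hx : ∀ y : chiKer μ, quad μ y = -∑ i, φ y i ^ 2 := fun y => hφ y (LinearMap.mem_ker.1 y.2)
    constructor
    · intro h y
      rw [hx, hx, Submodule.coe_add, map_add, h, add_zero]
    · intro h
      have h0 := h 0
      rw [zero_add, hx, hx, Submodule.coe_zero, map_zero] at h0
      have h1 : ∑ i, φ x i ^ 2 = 0 := by simpa using h0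
      rw [Finset.sum_eq_zero_iff_of_nonneg fun i _ => sq_nonneg _] at h1
      ext i
      simpa using h1 i (Finset.mem_univ i)
  have hr : LinearMap.range (f.comp (chiKer m).subtype) =
      LinearMap.range (f'.comp (chiKer m').subtype) := by
    ext a
    have e : a ∈ LinearMap.range (f.comp (chiKer m).subtype) ↔ ∃ x, chi m x = 0 ∧ f x = a :=
      ⟨fun ⟨x, hx⟩ => ⟨x, LinearMap.mem_ker.1 x.2, hx⟩,
        fun ⟨x, hx, hxa⟩ => ⟨⟨x, LinearMap.mem_ker.2 hx⟩, hxa⟩⟩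
    have e' : a ∈ LinearMap.range (f'.comp (chiKer m').subtype) ↔ ∃ x, chi m' x = 0 ∧ f' x = a :=
      ⟨fun ⟨x, hx⟩ => ⟨x, LinearMap.mem_ker.1 x.2, hx⟩,
        fun ⟨x, hx, hxa⟩ => ⟨⟨x, LinearMap.mem_ker.2 hx⟩, hxa⟩⟩
    rw [e, e', hrange, hrange']
  let E : TranscendentalLattice m ≃ₗ[ℤ] LinearMap.range (f.comp (chiKer m).subtype) :=
    (Submodule.quotEquivOfEq _ _ (key f hf).symm).trans (LinearMap.quotKerEquivRange _)
  let E' : TranscendentalLattice m' ≃ₗ[ℤ] LinearMap.range (f'.comp (chiKer m').subtype) :=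
    (Submodule.quotEquivOfEq _ _ (key f' hf').symm).trans (LinearMap.quotKerEquivRange _)
  have hE : ∀ x, latticeForm m x = -∑ i, (E x : Fin k → ℤ) i ^ 2 := fun x => by
    obtain ⟨x, rfl⟩ := Submodule.Quotient.mk_surjective _ x
    exact hf x (LinearMap.mem_ker.1 x.2)
  have hE' : ∀ x, latticeForm m' x = -∑ i, (E' x : Fin k → ℤ) i ^ 2 := fun x => by
    obtain ⟨x, rfl⟩ := Submodule.Quotient.mk_surjective _ x
    exact hf' x (LinearMap.mem_ker.1 x.2)
  refine ⟨(E.trans (LinearEquiv.ofEq _ _ hr)).trans E'.symm, fun x => ?_⟩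
  rw [hE, hE']
  simp

/-- A permutation and sign changes of the coordinates bring the linear equation to its standard
shape. -/
theorem exists_standardization {ι : Type*} [Fintype ι] {k : ℕ} (w : ι → ℤ)
    (hcard : Fintype.card ι = k) (hw : ∀ i, |w i| = 1 ∨ |w i| = 3)
    (hcount : Odd k → (∑ i, if |w i| = 3 then 1 else 0) = (k + 1) / 2) :
    ∃ e : ι ≃ Fin k, Odd k → ∀ i, |w i| = if (e i : ℕ) < (k + 1) / 2 then 3 else 1 := by
  by_cases hk : Odd k
  · have h1 : Fintype.card {i : ι // |w i| = 3} =
        Fintype.card {j : Fin k // (j : ℕ) < (k + 1) / 2} := by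
      rw [Fintype.card_subtype, Fintype.card_subtype, Finset.card_filter, hcount hk]
      have hle : (k + 1) / 2 ≤ k := by
        obtain ⟨c, rfl⟩ := hk
        omega
      rw [Fin.card_filter_val_lt]
      omega
    have h2 : Fintype.card {i : ι // ¬ |w i| = 3} =
        Fintype.card {j : Fin k // ¬ (j : ℕ) < (k + 1) / 2} := by
      rw [Fintype.card_subtype_compl, Fintype.card_subtype_compl, h1, hcard, Fintype.card_fin]
    let e : ι ≃ Fin k := (Equiv.sumCompl fun i => |w i| = 3).symm.trans
      ((Equiv.sumCongr (Fintype.equivOfCardEq h1) (Fintype.equivOfCardEq h2)).trans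
        (Equiv.sumCompl fun j : Fin k => (j : ℕ) < (k + 1) / 2))
    refine ⟨e, fun _ i => ?_⟩
    by_cases hi : |w i| = 3
    · have : e i = (Fintype.equivOfCardEq h1 ⟨i, hi⟩ : Fin k) := by
        simp [e, Equiv.sumCompl_symm_apply_of_pos, hi]
      rw [this, if_pos (Fintype.equivOfCardEq h1 ⟨i, hi⟩).2, hi]
    · have : e i = (Fintype.equivOfCardEq h2 ⟨i, hi⟩ : Fin k) := by
        simp [e, Equiv.sumCompl_symm_apply_of_neg, hi]
      rw [this, if_neg (Fintype.equivOfCardEq h2 ⟨i, hi⟩).2]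
      exact (hw i).resolve_right hi
  · exact ⟨Fintype.equivFinOfCardEq hcard, fun h => absurd h hk⟩

/-- On `ker χ` the two values of `χ` determine each other through `𝕐`, the interaction term vanishes
and the hyperbolic terms cancel. One value `z` stays free in the relation, with coefficient
`leafSign r + leafSign s`: it is `±2` for `k` even, leaving a parity condition, and `0` for `k` odd,
leaving a linear equation. -/
theorem HasBranchForm.joined {r s k : ℕ} {m : Factorization SL(2, ℤ) r}
    {m' : Factorization SL(2, ℤ) s} (hl : HasBranchForm m) (hr : HasBranchForm m')
    (hk : r + s = k + 2) :
    HasStandardForm (Fin.append m (conjFactorization matY m') : Factorization SL(2, ℤ) (r + s))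
      k := by
  obtain ⟨ι, _, u, w, hcard, hw, hcount, hquad, hrel⟩ := hl
  obtain ⟨ι', _, u', w', hcard', hw', hcount', hquad', hrel'⟩ := hr
  let M : Factorization SL(2, ℤ) (r + s) := Fin.append m (conjFactorization matY m')
  let p : (Fin (r + s) → Fin 2 → ℤ) →ₗ[ℤ] (Fin r → Fin 2 → ℤ) := restrictLeft _ _
  let p' : (Fin (r + s) → Fin 2 → ℤ) →ₗ[ℤ] (Fin s → Fin 2 → ℤ) :=
    (diagMul matY⁻¹ _).comp (restrictRight _ _)
  let W : ι ⊕ ι' → ℤ := Sum.elim w fun i => -leafSign s * w' i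
  have hWr : ∀ i, |W (Sum.inr i)| = |w' i| := fun i => by
    change |-leafSign s * w' i| = _
    rw [abs_mul, abs_neg, abs_leafSign, one_mul]
  have hW : ∀ i, |W i| = 1 ∨ |W i| = 3 := by
    rintro (i | i)
    · exact hw i
    · rw [hWr]
      exact hw' i
  have hWcard : Fintype.card (ι ⊕ ι') = k := by
    rw [Fintype.card_sum]
    omega
  obtain ⟨e, he⟩ := exists_standardization W hWcard hW fun hodd => by
    rw [Fintype.sum_sum_type]
    simp only [hWr]
    change (∑ i, if |w i| = 3 then 1 else 0) + _ = _
    rw [hcount, hcount']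
    obtain ⟨c, rfl⟩ := hodd
    omega
  have hsgn : ∀ i, (W i).sign * (W i).sign = 1 := fun i => by
    have h0 : W i ≠ 0 := fun h0 => by
      have := hW i
      rw [h0] at this
      simp at this
    rcases lt_or_gt_of_ne h0 with h | h
    · rw [Int.sign_eq_neg_one_of_neg h]
      rfl
    · rw [Int.sign_eq_one_of_pos h]
      rfl
  let U : (Fin (r + s) → Fin 2 → ℤ) →ₗ[ℤ] (ι ⊕ ι' → ℤ) :=
    LinearMap.pi (Sum.elim (fun i => (LinearMap.proj i).comp (u.comp p))
      fun i => (LinearMap.proj i).comp (u'.comp p'))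
  have hU1 : ∀ x i, U x (Sum.inl i) = u (p x) i := fun x i => rfl
  have hU2 : ∀ x i, U x (Sum.inr i) = u' (p' x) i := fun x i => rfl
  -- Sign changes preserve the sum of squares and make all coefficients positive.
  let f : (Fin (r + s) → Fin 2 → ℤ) →ₗ[ℤ] (Fin k → ℤ) :=
    LinearMap.pi fun j => (W (e.symm j)).sign • (LinearMap.proj (e.symm j)).comp U
  have hf : ∀ x j, f x j = (W (e.symm j)).sign * U x (e.symm j) := fun x j => rfl
  have hY : ∀ y : Fin 2 → ℤ, (matY : Matrix (Fin 2) (Fin 2) ℤ) *ᵥ y = ![-y 1, y 0] := fun y => by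
    ext i
    fin_cases i <;> simp [matY, Matrix.vecHead, Matrix.vecTail]
  have hchi : ∀ x, chi M x = chi m (p x) + ![-chi m' (p' x) 1, chi m' (p' x) 0] := fun x => by
    rw [chi_append, chi_conj, hY]
    rfl
  have hker : ∀ x, chi M x = 0 ↔
      chi m (p x) 0 = chi m' (p' x) 1 ∧ chi m (p x) 1 = -chi m' (p' x) 0 := fun x => by
    rw [hchi, funext_iff, Fin.forall_fin_two]
    simp only [Pi.add_apply, Matrix.cons_val_zero, Matrix.cons_val_one, Pi.zero_apply]
    constructor <;> rintro ⟨h1, h2⟩ <;> constructor <;> linarith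
  have hrelU : ∀ a : ι ⊕ ι' → ℤ, (∃ x, chi M x = 0 ∧ U x = a) ↔
      ∃ z : ℤ, ∑ i, W i * a i + (leafSign r + leafSign s) * z = 0 := by
    intro a
    rw [Fintype.sum_sum_type]
    have hs : ∑ i, W (Sum.inr i) * a (Sum.inr i) =
        -leafSign s * ∑ i, w' i * a (Sum.inr i) := by
      rw [Finset.mul_sum]
      exact Finset.sum_congr rfl fun i _ => mul_assoc _ _ _
    rw [hs]
    change _ ↔ ∃ z : ℤ, ∑ i, w i * a (Sum.inl i) + _ + _ = 0
    have hsq := leafSign_mul_self s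
    constructor
    · rintro ⟨x, hx, rfl⟩
      have h := (hrel (u (p x)) (chi m (p x))).1 ⟨_, rfl, rfl⟩
      have h' := (hrel' (u' (p' x)) (chi m' (p' x))).1 ⟨_, rfl, rfl⟩
      obtain ⟨h1, h2⟩ := (hker x).1 hx
      refine ⟨chi m (p x) 1, ?_⟩
      simp only [hU1, hU2]
      linear_combination h - leafSign s * h' - h1 + leafSign s * h2 + chi m' (p' x) 1 * hsq
    · rintro ⟨z, hz⟩
      -- Here `(y, z)` is the value of `χ` on the left, with `y` solved from the left relation;
      -- vanishing of the total `χ` forces `(-z, y)` on the right.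
      let y : ℤ := -(∑ i, w i * a (Sum.inl i)) - leafSign r * z
      obtain ⟨x₁, hx₁, hc₁⟩ := (hrel (fun i => a (Sum.inl i)) ![y, z]).2 (by
        simp only [Matrix.cons_val_zero, Matrix.cons_val_one, y]
        ring)
      obtain ⟨x₂, hx₂, hc₂⟩ := (hrel' (fun i => a (Sum.inr i)) ![-z, y]).2 (by
        simp only [Matrix.cons_val_zero, Matrix.cons_val_one, y]
        linear_combination -leafSign s * hz -
          (∑ i, w' i * a (Sum.inr i)) * hsq + z * hsq)
      let x : Fin (r + s) → Fin 2 → ℤ := Fin.append x₁ (diagMul matY _ x₂)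
      have hp : p x = x₁ := restrictLeft_append _ _
      have hp' : p' x = x₂ := by
        change diagMul _ _ (restrictRight _ _ x) = _
        rw [restrictRight_append, diagMul_inv_diagMul]
      refine ⟨x, ?_, ?_⟩
      · rw [hker, hp, hp', hc₁, hc₂]
        simp
      · funext o
        rcases o with i | i
        · rw [hU1, hp, hx₁]
        · rw [hU2, hp', hx₂]
  refine ⟨f, fun x hx => ?_, fun a => ?_⟩
  · obtain ⟨h1, h2⟩ := (hker x).1 hx
    have hq : quad M x = quad m (p x) + quad m' (p' x) +
        skew (chi m (p x)) ![-chi m' (p' x) 1, chi m' (p' x) 0] := by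
      rw [quad_append, quad_conj, chi_conj, hY]
      rfl
    have hsum : ∑ j, f x j ^ 2 = ∑ i, U x i ^ 2 := by
      rw [← e.sum_comp]
      refine Finset.sum_congr rfl fun i _ => ?_
      rw [hf, e.symm_apply_apply, mul_pow, pow_two (W i).sign, hsgn, one_mul]
    rw [hsum, Fintype.sum_sum_type]
    simp only [hU1, hU2]
    change quad M x = _
    rw [hq, hquad, hquad']
    simp only [skew, Matrix.cons_val_zero, Matrix.cons_val_one, h1, h2]
    ring
  · have h1 : (∃ x, chi M x = 0 ∧ f x = a) ↔
        ∃ x, chi M x = 0 ∧ U x = fun i => (W i).sign * a (e i) := by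
      refine exists_congr fun x => and_congr_right fun _ => ?_
      constructor
      · rintro rfl
        funext i
        rw [hf, e.symm_apply_apply, ← mul_assoc, hsgn, one_mul]
      · intro h
        funext j
        rw [hf, h, ← mul_assoc, hsgn, one_mul, e.apply_symm_apply]
    change (∃ x, chi M x = 0 ∧ f x = a) ↔ _
    rw [h1, hrelU]
    have h2 : ∀ i, W i * ((W i).sign * a (e i)) = |W i| * a (e i) := fun i => by
      rw [← mul_assoc, mul_comm (W i), Int.sign_mul_self_eq_abs]
    simp only [h2]
    rw [IsStandardVector]
    split_ifs with heven
    -- All coefficients are odd, so modulo `2` the numbers of ones and threes do not matter.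
    · have hpar : ∑ i, |W i| * a (e i) ≡ ∑ j, a j [ZMOD 2] := by
        rw [← e.sum_comp]
        refine Int.ModEq.sum fun i _ => ?_
        rcases hW i with h | h <;> rw [h] <;> simp [Int.ModEq]
        omega
      rw [Int.even_iff, ← hpar]
      rcases leafSign_eq r with ⟨hr1, hr2⟩ | ⟨hr1, hr2⟩ <;>
        rcases leafSign_eq s with ⟨hs1, hs2⟩ | ⟨hs1, hs2⟩ <;> rw [hr1, hs1]
      · exact ⟨fun ⟨z, hz⟩ => by omega,
          fun h => ⟨-((∑ i, |W i| * a (e i)) / 2), by omega⟩⟩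
      · have := Nat.even_iff.1 heven
        omega
      · have := Nat.even_iff.1 heven
        omega
      · exact ⟨fun ⟨z, hz⟩ => by omega,
          fun h => ⟨(∑ i, |W i| * a (e i)) / 2, by omega⟩⟩
    · have hodd : Odd k := Nat.not_even_iff_odd.1 heven
      have hsum : ∑ j : Fin k, (if (j : ℕ) < (k + 1) / 2 then 3 else 1) * a j =
          ∑ i, |W i| * a (e i) := by
        rw [← e.sum_comp]
        exact Finset.sum_congr rfl fun i _ => by rw [he hodd]
      have h0 : leafSign r + leafSign s = 0 := by
        have := Nat.odd_iff.1 hodd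
        rcases leafSign_eq r with ⟨hr1, hr2⟩ | ⟨hr1, hr2⟩ <;>
          rcases leafSign_eq s with ⟨hs1, hs2⟩ | ⟨hs1, hs2⟩ <;> omega
      rw [hsum, h0]
      simp

theorem hasStandardForm_joined {k : ℕ} (l r : BinaryTree Unit)
    (hk : l.numLeaves + r.numLeaves = k + 2) : HasStandardForm (joined matX matY l r) k :=
  (hasBranchForm_branch l).joined (hasBranchForm_branch r) hk

end ClosedForm

/-! ### Relations of the fundamental group of a tree -/

/-- A braid lift of `𝕏`. -/
def braidX : B3 := (sigma 1 * sigma 0)⁻¹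

/-- A braid lift of `𝕐`. -/
def braidY : B3 := sigma 1 * sigma 0 * sigma 0

theorem sigma_braid : sigma 0 * sigma 1 * sigma 0 = sigma 1 * sigma 0 * sigma 1 := by
  have h : PresentedGroup.mk braidRels (FreeGroup.of 0 * FreeGroup.of 1 * FreeGroup.of 0 *
      (FreeGroup.of 1 * FreeGroup.of 0 * FreeGroup.of 1)⁻¹) = 1 :=
    PresentedGroup.one_of_mem rfl
  rw [map_mul, map_inv, mul_inv_eq_one] at h
  simp only [map_mul] at h
  exact h

theorem braidX_mul_braidY : braidX * braidY = sigma 0 := by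
  simp [braidX, braidY, mul_assoc]

theorem braidX_inv_mul_braidY :
    braidX⁻¹ * braidY = sigma 1 * sigma 0 * sigma 1 * sigma 0 * sigma 0 := by
  simp [braidX, braidY, mul_assoc]

/-- The entry of a leaf is the generator `σ₂` itself, whence the relation `q = r` at a leaf. -/
theorem braidX_conj : braidX * (braidX * braidY) * braidX⁻¹ = sigma 1 := by
  rw [braidX_mul_braidY, braidX, inv_inv, mul_assoc, inv_mul_eq_iff_eq_mul, ← mul_assoc,
    sigma_braid]

theorem braidToPSL_sigma_zero : braidToPSL (sigma 0) = projX * projY := by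
  simp [braidToPSL, braidToSL, braidLift, sigma, projX, projY]

theorem braidToPSL_sigma_one : braidToPSL (sigma 1) = projX ^ 2 * projY * projX⁻¹ := by
  simp [braidToPSL, braidToSL, braidLift, sigma, projX, projY]

theorem braidToPSL_braidX : braidToPSL braidX = projX := by
  rw [braidX, map_inv, map_mul, braidToPSL_sigma_zero, braidToPSL_sigma_one, ← mul_assoc,
    inv_mul_cancel_right, mul_assoc, ← pow_two projY, projY_pow, mul_one, pow_two, projX_mul_self,
    inv_inv]

theorem braidToPSL_braidY : braidToPSL braidY = projY := by
  have h : braidY = braidX⁻¹ * sigma 0 := by rw [← braidX_mul_braidY, inv_mul_cancel_left]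
  rw [h, map_mul, map_inv, braidToPSL_braidX, braidToPSL_sigma_zero, inv_mul_cancel_left]

theorem artin_sigma_zero : artin (sigma 0) = artinGen 0 1 (by decide) := by
  simp [artin, braidLift, sigma]

theorem artin_sigma_one : artin (sigma 1) = artinGen 1 2 (by decide) := by
  simp [artin, braidLift, sigma]

/-! ### Consequences of the braid relations in an arbitrary group -/

section Relations

variable {G : Type*} [Group G]

/-- The homomorphism `φ` is invariant under the Artin action of `β`. -/
def IsFixedBy (φ : FreeGroup (Fin 3) →* G) (β : B3) : Prop := ∀ w, φ (artin β w) = φ w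

/-- Conjugating a braid amounts to changing the basis of the free group; this lets the relations of
a subtree be read in a transported triple of generators. -/
theorem IsFixedBy.of_conj {φ : FreeGroup (Fin 3) →* G} {g β : B3}
    (h : IsFixedBy φ (g * β * g⁻¹)) : IsFixedBy (φ.comp (artin g).toMonoidHom) β := fun w => by
  have := h (artin g w)
  rw [← MulAut.mul_apply, ← map_mul, inv_mul_cancel_right, map_mul] at this
  exact this

/-- The relations which the branch of shape `t` imposes on the images of the three generators. -/
def BranchRelation : BinaryTree Unit → G → G → G → Prop
  | nil, _, q, r => q = r
  | node _ t t', p, q, r =>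
    BranchRelation t (p * q * p⁻¹) p r ∧
    BranchRelation t' (p * q * r * q * r * q⁻¹ * r⁻¹ * q⁻¹ * p⁻¹)
      (p * q * r * q * r⁻¹ * q⁻¹ * p⁻¹) p

theorem branchRelation_of_isFixedBy (t : BinaryTree Unit) {φ : FreeGroup (Fin 3) →* G}
    (h : ∀ i, IsFixedBy φ (branch braidX braidY t i)) :
    BranchRelation t (φ (FreeGroup.of 0)) (φ (FreeGroup.of 1)) (φ (FreeGroup.of 2)) := by
  induction t generalizing φ with
  | nil =>
    have h1 : IsFixedBy φ (braidX * (braidX * braidY) * braidX⁻¹) := h ⟨0, by simp⟩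
    rw [braidX_conj] at h1
    have h2 := h1 (FreeGroup.of 2)
    rw [artin_sigma_one] at h2
    simpa [artinGen, BranchRelation] using h2
  | node _ l r hl hr =>
    have h1 := hl (φ := φ.comp (artin (braidX * braidY)).toMonoidHom) fun i =>
      IsFixedBy.of_conj (by simpa [branch, conjFactorization] using h (Fin.castAdd _ i))
    have h2 := hr (φ := φ.comp (artin (braidX⁻¹ * braidY)).toMonoidHom) fun i =>
      IsFixedBy.of_conj (by simpa [branch, conjFactorization] using h (Fin.natAdd _ i))
    rw [braidX_mul_braidY, artin_sigma_zero] at h1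
    rw [braidX_inv_mul_braidY, map_mul, map_mul, map_mul, map_mul, artin_sigma_zero,
      artin_sigma_one] at h2
    refine ⟨by simpa [artinGen] using h1, ?_⟩
    convert h2 using 1
    all_goals simp [artinGen, mul_assoc]

/-- The relations of a tree with two leaves. -/
theorem BranchRelation.cherry {u : Unit} {p q r : G}
    (h : BranchRelation (node u nil nil) p q r) : p = r ∧ q * p * q = p * q * p := by
  obtain ⟨h1, h2⟩ := h
  change p = r at h1
  subst h1
  change p * q * p * q * p⁻¹ * q⁻¹ * p⁻¹ = p at h2
  refine ⟨rfl, ?_⟩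
  have h3 : p * q * p * q * p⁻¹ * q⁻¹ * p⁻¹ * (p * q * p) = p * (p * q * p) := by rw [h2]
  have h4 : p * (q * p * q) = p * (p * q * p) := by
    rw [← h3]
    group
  exact mul_left_cancel h4

theorem eq_of_numLeaves_eq_one {t : BinaryTree Unit} (h : t.numLeaves = 1) : t = nil := by
  cases t with
  | nil => rfl
  | node _ l r =>
    have := l.numLeaves_pos
    have := r.numLeaves_pos
    simp only [numLeaves] at h
    omega

theorem eq_of_numLeaves_eq_two {t : BinaryTree Unit} (h : t.numLeaves = 2) :
    t = node () nil nil := by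
  cases t with
  | nil => simp at h
  | node _ l r =>
    have := l.numLeaves_pos
    have := r.numLeaves_pos
    simp only [numLeaves] at h
    rw [eq_of_numLeaves_eq_one (t := l) (by omega), eq_of_numLeaves_eq_one (t := r) (by omega)]

/-- The endgame when the left subtree has two leaves; `h3` is what the right subtree contributes. -/
theorem eq_of_cherry_left {p q r : G} (h1 : p * q * p⁻¹ = r) (h2 : p * r * p = r * p * r)
    (h3 : q * r * q = p * q * r) : p = q ∧ q = r := by
  have h4 : p * q = r * p := by rw [← h1]; group
  have h5 : r * p = q * r := by
    have : p * (r * p) = p * (q * r) := by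
      rw [← mul_assoc, h2, ← h4, mul_assoc]
    exact mul_left_cancel this
  have h6 : q = r := by
    have : q * r * q = q * r * r := by rw [h3, h4, h5]
    exact mul_left_cancel this
  subst h6
  have h7 : p = q := by
    have : q * p * p = q * p * q := by rw [← h2, h4]
    exact mul_left_cancel this
  exact ⟨h7, rfl⟩

/-- The endgame for a leaf on the left and two leaves on the right: the braid relation of length
four and that of length three together force equality. -/
theorem eq_of_cherry_right {p q : G} (h1 : p * q * p * q = q * p * q * p)
    (h2 : q * p * q = p * q * p) : p = q := by
  have h3 : p * q * p = q * p * p := by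
    have : p * (p * q * p) = p * (q * p * p) := by
      calc p * (p * q * p) = p * (q * p * q) := by rw [h2]
        _ = p * q * p * q := by group
        _ = q * p * q * p := h1
        _ = p * (q * p * p) := by rw [h2]; group
    exact mul_left_cancel this
  have : q * p * p = q * p * q := by rw [h2, h3]
  exact mul_left_cancel this

/-- A branch with at least three leaves makes the three generators equal. -/
theorem BranchRelation.eq_of_three_le {t : BinaryTree Unit} (ht : 3 ≤ t.numLeaves) {p q r : G}
    (h : BranchRelation t p q r) : p = q ∧ q = r := by
  induction t generalizing p q r with
  | nil => simp at ht
  | node _ s s' hs hs' =>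
    obtain ⟨h1, h2⟩ := h
    set a := p * q * r * q * r⁻¹ * q⁻¹ * p⁻¹ with ha
    set b := p * q * r * q * r * q⁻¹ * r⁻¹ * q⁻¹ * p⁻¹ with hb
    -- The first generator seen by the right subtree is thus a conjugate, by the second one, of `p *
    -- q * r * q⁻¹ * p⁻¹`.
    have hab : b * a = a * (p * q * r * q⁻¹ * p⁻¹) := by
      rw [ha, hb]
      group
    by_cases hs3 : 3 ≤ s.numLeaves
    · obtain ⟨h3, rfl⟩ := hs hs3 h1
      have h4 : q = p := by
        have : p * q = p * p := by rwa [mul_inv_eq_iff_eq_mul] at h3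
        exact mul_left_cancel this
      exact ⟨h4.symm, h4⟩
    by_cases hs3' : 3 ≤ s'.numLeaves
    · obtain ⟨h3, h4⟩ := hs' hs3' h2
      rw [h3, h4] at hab
      have h5 : p * q * r * q⁻¹ * p⁻¹ = p := (mul_left_cancel hab).symm
      have h6 : p * q * r = p * p * q := by
        calc p * q * r = p * q * r * q⁻¹ * p⁻¹ * (p * q) := by group
          _ = p * p * q := by rw [h5]; group
      have h7 : q * r * q = p * q * r := by
        have h8 : p * (q * r * q) = p * (p * q * r) := by
          calc p * (q * r * q) = a * (p * q * r) := by rw [ha]; group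
            _ = p * (p * q * r) := by rw [h4]
        exact mul_left_cancel h8
      have h9 : q * r = p * q := by
        have : p * (q * r) = p * (p * q) := by rw [← mul_assoc, h6, mul_assoc]
        exact mul_left_cancel this
      have h10 : q = r := by
        have : p * q * q = p * q * r := by rw [← h9, h7, h9]
        exact mul_left_cancel this
      subst h10
      exact ⟨(mul_right_cancel h9).symm, rfl⟩
    have hpos := s.numLeaves_pos
    have hpos' := s'.numLeaves_pos
    simp only [numLeaves] at ht
    by_cases hs1 : s.numLeaves = 1
    · obtain rfl := eq_of_numLeaves_eq_one hs1
      obtain rfl := eq_of_numLeaves_eq_two (t := s') (by omega)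
      change p = r at h1
      subst h1
      obtain ⟨h3, h4⟩ := h2.cherry
      have h5 : p * a = p * q := by
        calc p * a = a * (p * q * p * q⁻¹ * p⁻¹) := by rw [← hab, h3]
          _ = p * q := by rw [ha]; group
      have h6 : a = q := mul_left_cancel h5
      have h7 : p * q * p * q = q * p * q * p := by
        calc p * q * p * q = a * (p * q * p) := by rw [ha]; group
          _ = q * p * q * p := by rw [h6]; group
      rw [h3, h6] at h4
      have h8 := eq_of_cherry_right h7 h4
      exact ⟨h8, h8.symm⟩
    · obtain rfl := eq_of_numLeaves_eq_two (t := s) (by omega)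
      obtain ⟨h3, h4⟩ := h1.cherry
      rw [h3] at h4
      -- A right leaf gives this at once. If the right subtree has two leaves, the left relations
      -- turn `p * q * r * q⁻¹ * p⁻¹` into `p`, so `a` and `p` commute, and with the braid relation
      -- they coincide.
      have h5 : a = p := by
        by_cases hs1' : s'.numLeaves = 1
        · obtain rfl := eq_of_numLeaves_eq_one hs1'
          exact h2
        · obtain rfl := eq_of_numLeaves_eq_two (t := s') (by omega)
          obtain ⟨h6, h7⟩ := h2.cherry
          have h8 : p * q * r * q⁻¹ * p⁻¹ = p := by
            have e1 : p * q = r * p := by rw [← h3]; group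
            rw [e1, ← h4, mul_assoc p r p, ← e1]
            group
          rw [h6, h8] at hab
          rw [h6] at h7
          have h9 : p * a * a = p * a * p := by rw [← h7, hab]
          exact mul_left_cancel h9
      refine eq_of_cherry_left h3 h4 ?_
      have h8 : p * (q * r * q) = p * (p * q * r) := by
        calc p * (q * r * q) = a * (p * q * r) := by rw [ha]; group
          _ = p * (p * q * r) := by rw [h5]
      exact mul_left_cancel h8

/-- Two joined branches with at least four leaves make the three generators equal. -/
theorem BranchRelation.eq_of_joined {t t' : BinaryTree Unit} (ht : 4 ≤ t.numLeaves + t'.numLeaves)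
    {p q r : G} (h : BranchRelation t p q r)
    (h' : BranchRelation t' (p * q * r * q⁻¹ * p⁻¹ * p * (p * q * r * q⁻¹ * p⁻¹)⁻¹)
      (p * q * r * q⁻¹ * p⁻¹) q) : p = q ∧ q = r := by
  set R := p * q * r * q⁻¹ * p⁻¹ with hR
  have e : R * (p * q) = p * q * r := by rw [hR]; group
  by_cases ht3 : 3 ≤ t.numLeaves
  · exact h.eq_of_three_le ht3
  by_cases ht3' : 3 ≤ t'.numLeaves
  · obtain ⟨h1, h2⟩ := h'.eq_of_three_le ht3'
    rw [mul_inv_eq_iff_eq_mul] at h1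
    have h3 : p = R := mul_left_cancel h1
    rw [← h3] at h2
    subst h2
    rw [← h3] at e
    refine ⟨rfl, ?_⟩
    rw [← mul_assoc] at e
    exact mul_left_cancel e
  -- Neither branch suffices alone, so four leaves force two on each side.
  · obtain rfl := eq_of_numLeaves_eq_two (t := t) (by omega)
    obtain rfl := eq_of_numLeaves_eq_two (t := t') (by omega)
    obtain ⟨rfl, h1⟩ := h.cherry
    obtain ⟨h2, -⟩ := h'.cherry
    have h3 : R = q := by
      rw [← h1, mul_assoc q] at e
      exact mul_right_cancel e
    rw [h3, mul_inv_eq_iff_eq_mul] at h2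
    have h4 := mul_left_cancel h2
    exact ⟨h4, h4.symm⟩

theorem eq_of_isFixedBy_joined {l r : BinaryTree Unit} (hlr : 4 ≤ l.numLeaves + r.numLeaves)
    {φ : FreeGroup (Fin 3) →* G} (h : ∀ i, IsFixedBy φ (joined braidX braidY l r i)) :
    φ (FreeGroup.of 0) = φ (FreeGroup.of 1) ∧ φ (FreeGroup.of 1) = φ (FreeGroup.of 2) := by
  have h1 := branchRelation_of_isFixedBy l (φ := φ) fun i => by
    simpa [joined] using h (Fin.castAdd _ i)
  have h2 := branchRelation_of_isFixedBy r (φ := φ.comp (artin braidY).toMonoidHom) fun i =>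
    IsFixedBy.of_conj (by simpa [joined, conjFactorization] using h (Fin.natAdd _ i))
  refine h1.eq_of_joined hlr ?_
  rw [braidY, map_mul, map_mul, artin_sigma_zero, artin_sigma_one] at h2
  convert h2 using 1
  all_goals simp [artinGen, mul_assoc]

end Relations

/-! ### Fundamental groups -/

/-- The projection to the fundamental group of a set of braids. -/
def fundamentalGroupMk (S : Set B3) : FreeGroup (Fin 3) →* braidFundamentalGroup S :=
  PresentedGroup.mk _

theorem isFixedBy_fundamentalGroupMk {S : Set B3} {β : B3} (hβ : β ∈ S) :
    IsFixedBy (fundamentalGroupMk S) β := by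
  have h : (fundamentalGroupMk S).comp (artin β).toMonoidHom = fundamentalGroupMk S := by
    ext j
    have h1 : fundamentalGroupMk S (artin β (FreeGroup.of j) * (FreeGroup.of j)⁻¹) = 1 :=
      PresentedGroup.one_of_mem ⟨β, hβ, j, rfl⟩
    rw [map_mul, map_inv, mul_inv_eq_one] at h1
    exact h1
  exact fun w => DFunLike.congr_fun h w

/-- A homomorphism that is invariant under a set of braids factors through the fundamental
group. -/
def fundamentalGroupLift {G : Type*} [Group G] {S : Set B3} (φ : FreeGroup (Fin 3) →* G)
    (h : ∀ β ∈ S, IsFixedBy φ β) : braidFundamentalGroup S →* G :=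
  PresentedGroup.toGroup (f := fun j => φ (FreeGroup.of j)) (by
    rintro _ ⟨β, hβ, j, rfl⟩
    have e : FreeGroup.lift (fun j => φ (FreeGroup.of j)) = φ := by
      ext j
      simp
    rw [e, map_mul, map_inv, h β hβ, mul_inv_cancel])

theorem fundamentalGroupLift_mk {G : Type*} [Group G] {S : Set B3} (φ : FreeGroup (Fin 3) →* G)
    (h : ∀ β ∈ S, IsFixedBy φ β) (w : FreeGroup (Fin 3)) :
    fundamentalGroupLift φ h (fundamentalGroupMk S w) = φ w := by
  have e : (fundamentalGroupLift φ h).comp (fundamentalGroupMk S) = φ := by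
    ext j
    change fundamentalGroupLift φ h (PresentedGroup.of j) = _
    rw [fundamentalGroupLift, PresentedGroup.toGroup.of]
  exact DFunLike.congr_fun e w

theorem fundamentalGroup_hom_ext {G : Type*} [Group G] {S : Set B3}
    {f g : braidFundamentalGroup S →* G}
    (h : ∀ w, f (fundamentalGroupMk S w) = g (fundamentalGroupMk S w)) : f = g :=
  PresentedGroup.ext fun j => h (FreeGroup.of j)

theorem isFixedBy_conj {G : Type*} [Group G] {φ : FreeGroup (Fin 3) →* G} {g β : B3}
    (h : IsFixedBy φ (g⁻¹ * β * g)) : IsFixedBy (φ.comp (artin g⁻¹).toMonoidHom) β :=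
  IsFixedBy.of_conj (by rwa [inv_inv])

/-- Conjugate sets of braids have isomorphic fundamental groups. -/
theorem nonempty_equiv_of_conj {S T : Set B3} (g : B3) (h : ∀ β, β ∈ T ↔ g⁻¹ * β * g ∈ S) :
    Nonempty (braidFundamentalGroup T ≃* braidFundamentalGroup S) := by
  let f : braidFundamentalGroup T →* braidFundamentalGroup S :=
    fundamentalGroupLift ((fundamentalGroupMk S).comp (artin g⁻¹).toMonoidHom) fun β hβ =>
      isFixedBy_conj (isFixedBy_fundamentalGroupMk ((h β).1 hβ))
  let f' : braidFundamentalGroup S →* braidFundamentalGroup T :=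
    fundamentalGroupLift ((fundamentalGroupMk T).comp (artin g).toMonoidHom) fun β hβ =>
      IsFixedBy.of_conj (isFixedBy_fundamentalGroupMk ((h _).2 (by
        simpa [mul_assoc] using hβ)))
  have hf : ∀ w, f (fundamentalGroupMk T w) = fundamentalGroupMk S (artin g⁻¹ w) :=
    fundamentalGroupLift_mk _ _
  have hf' : ∀ w, f' (fundamentalGroupMk S w) = fundamentalGroupMk T (artin g w) :=
    fundamentalGroupLift_mk _ _
  refine ⟨MonoidHom.toMulEquiv f f' (fundamentalGroup_hom_ext fun w => ?_)
    (fundamentalGroup_hom_ext fun w => ?_)⟩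
  · rw [MonoidHom.comp_apply, hf, hf', ← MulAut.mul_apply, ← map_mul, mul_inv_cancel, map_one]
    rfl
  · rw [MonoidHom.comp_apply, hf', hf, ← MulAut.mul_apply, ← map_mul, inv_mul_cancel, map_one]
    rfl

/-- The homomorphism from the free group to `ℤ` that sends each generator to `1`. -/
def degreeHom : FreeGroup (Fin 3) →* Multiplicative ℤ :=
  FreeGroup.lift fun _ => Multiplicative.ofAdd 1

/-- The Artin generators permute the free generators up to conjugation, so every braid preserves the
degree. -/
theorem isFixedBy_degreeHom (β : B3) : IsFixedBy degreeHom β := by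
  have hβ : β ∈ Subgroup.closure (Set.range (PresentedGroup.of (rels := braidRels))) := by
    rw [PresentedGroup.closure_range_of]
    trivial
  have hgen : ∀ j, IsFixedBy degreeHom (sigma j) := fun j => by
    have e : degreeHom.comp (artin (sigma j)).toMonoidHom = degreeHom := by
      fin_cases j
      · change degreeHom.comp (artin (sigma 0)).toMonoidHom = degreeHom
        rw [artin_sigma_zero]
        ext i
        fin_cases i <;> simp [artinGen, degreeHom]
      · change degreeHom.comp (artin (sigma 1)).toMonoidHom = degreeHom
        rw [artin_sigma_one]
        ext i
        fin_cases i <;> simp [artinGen, degreeHom]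
    exact fun w => DFunLike.congr_fun e w
  induction hβ using Subgroup.closure_induction with
  | mem _ h =>
    obtain ⟨j, rfl⟩ := h
    exact hgen j
  | one => exact fun w => by rw [map_one]; rfl
  | mul a b _ _ ha hb => exact fun w => by rw [map_mul, MulAut.mul_apply, ha, hb]
  | inv a _ ha =>
    intro w
    rw [← ha, ← MulAut.mul_apply, ← map_mul, mul_inv_cancel, map_one]
    rfl

/-- Equal generators make the group cyclic, and the degree survives whatever the relations are. -/
theorem nonempty_equiv_int {S : Set B3}
    (h1 : fundamentalGroupMk S (FreeGroup.of 0) = fundamentalGroupMk S (FreeGroup.of 1))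
    (h2 : fundamentalGroupMk S (FreeGroup.of 1) = fundamentalGroupMk S (FreeGroup.of 2)) :
    Nonempty (braidFundamentalGroup S ≃* Multiplicative ℤ) := by
  let f : braidFundamentalGroup S →* Multiplicative ℤ :=
    fundamentalGroupLift degreeHom fun β _ => isFixedBy_degreeHom β
  have hf : ∀ w, f (fundamentalGroupMk S w) = degreeHom w := fundamentalGroupLift_mk _ _
  let f' : Multiplicative ℤ →* braidFundamentalGroup S :=
    zpowersHom _ (fundamentalGroupMk S (FreeGroup.of 0))
  refine ⟨MonoidHom.toMulEquiv f f' (PresentedGroup.ext fun j => ?_) ?_⟩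
  · change f' (f (fundamentalGroupMk S (FreeGroup.of j))) = fundamentalGroupMk S (FreeGroup.of j)
    have e : f' (degreeHom (FreeGroup.of j)) = fundamentalGroupMk S (FreeGroup.of 0) := by
      simp [f', degreeHom]
    rw [hf, e]
    fin_cases j
    · rfl
    · exact h1
    · exact h1.trans h2
  · ext
    change f (f' (Multiplicative.ofAdd 1)) = Multiplicative.ofAdd 1
    have e : f' (Multiplicative.ofAdd 1) = fundamentalGroupMk S (FreeGroup.of 0) := by
      simp [f']
    rw [e, hf]
    simp [degreeHom]

theorem simpleBraidLifts_congr {r s : ℕ} {m : Factorization PSL(2, ℤ) r}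
    {m' : Factorization PSL(2, ℤ) s} (h : Set.range m = Set.range m') :
    simpleBraidLifts m = simpleBraidLifts m' := by
  have e : ∀ {n : ℕ} (μ : Factorization PSL(2, ℤ) n), simpleBraidLifts μ =
      {β | IsConj (sigma 0) β ∧ braidToPSL β ∈ Set.range μ} := fun μ => by
    simp only [simpleBraidLifts, Set.mem_range, eq_comm]
  rw [e, e, h]

theorem nonempty_equiv_conjFactorization {r : ℕ} (m : Factorization PSL(2, ℤ) r) (g : B3) :
    Nonempty (SimpleFundamentalGroup (conjFactorization (braidToPSL g) m) ≃*
      SimpleFundamentalGroup m) := by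
  refine nonempty_equiv_of_conj g fun β => and_congr ?_ (exists_congr fun i => ?_)
  · have hc : IsConj β (g⁻¹ * β * g) := isConj_iff.2 ⟨g⁻¹, by rw [inv_inv]⟩
    exact ⟨fun h => h.trans hc, fun h => h.trans hc.symm⟩
  · rw [map_mul, map_mul, map_inv, conjFactorization]
    constructor
    · intro h
      rw [h]
      group
    · intro h
      rw [← h]
      group

/-- Membership of these explicit lifts is enough: further lifts could only add relations, which the
degree map respects anyway. Uniqueness of the lifts is not needed. -/
theorem joined_mem_simpleBraidLifts (l r : BinaryTree Unit)
    (i : Fin (l.numLeaves + r.numLeaves)) :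
    joined braidX braidY l r i ∈ simpleBraidLifts (joined projX projY l r) := by
  refine ⟨?_, i, ?_⟩
  · rw [← braidX_mul_braidY]
    exact isConj_joined _ _ _ _ _
  · have := map_joined braidToPSL braidX braidY l r
    rw [braidToPSL_braidX, braidToPSL_braidY] at this
    exact congrFun this i

theorem nonempty_equiv_int_joined {l r : BinaryTree Unit}
    (h : 4 ≤ l.numLeaves + r.numLeaves) :
    Nonempty (SimpleFundamentalGroup (joined projX projY l r) ≃* Multiplicative ℤ) := by
  obtain ⟨h1, h2⟩ := eq_of_isFixedBy_joined h
    (φ := fundamentalGroupMk (simpleBraidLifts (joined projX projY l r))) fun i =>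
      isFixedBy_fundamentalGroupMk (joined_mem_simpleBraidLifts l r i)
  exact nonempty_equiv_int h1 h2

/-- Conjugation by `𝕐` moves the base point to the other side of the joining edge. Only the set of
entries matters for the fundamental group. -/
theorem nonempty_equiv_joined_swap (l r : BinaryTree Unit) :
    Nonempty (SimpleFundamentalGroup (joined projX projY l r) ≃*
      SimpleFundamentalGroup (joined projX projY r l)) := by
  have h : Set.range (joined projX projY l r) =
      Set.range (conjFactorization (braidToPSL braidY) (joined projX projY r l)) := by
    rw [braidToPSL_braidY, joined, joined, conjFactorization_append, ← conjFactorization_mul,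
      range_append, range_append, Set.union_comm, ← pow_two, projY_pow]
    congr 2
    funext i
    simp [conjFactorization]
  obtain ⟨e⟩ := nonempty_equiv_conjFactorization (joined projX projY r l) braidY
  change Nonempty (braidFundamentalGroup (simpleBraidLifts _) ≃* _)
  rw [simpleBraidLifts_congr h]
  exact ⟨e⟩

/-- From four leaves on both groups are `ℤ`. Below that, each branch has at most two leaves, so its
shape is determined by its leaf count and only the order of the branches can differ. -/
theorem nonempty_equiv_joined {l r l' r' : BinaryTree Unit}
    (h : l.numLeaves + r.numLeaves = l'.numLeaves + r'.numLeaves) :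
    Nonempty (SimpleFundamentalGroup (joined projX projY l r) ≃*
      SimpleFundamentalGroup (joined projX projY l' r')) := by
  by_cases h4 : 4 ≤ l.numLeaves + r.numLeaves
  · obtain ⟨e⟩ := nonempty_equiv_int_joined h4
    obtain ⟨e'⟩ := nonempty_equiv_int_joined (h ▸ h4)
    exact ⟨e.trans e'.symm⟩
  have h1 := l.numLeaves_pos
  have h2 := r.numLeaves_pos
  have h3 := l'.numLeaves_pos
  have h5 := r'.numLeaves_pos
  have hsmall : ∀ {t t' : BinaryTree Unit}, t.numLeaves ≤ 2 → t.numLeaves = t'.numLeaves →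
      t = t' := fun {t t'} ht htt' => by
    have := t.numLeaves_pos
    obtain ht1 | ht2 : t.numLeaves = 1 ∨ t.numLeaves = 2 := by omega
    · rw [eq_of_numLeaves_eq_one ht1, eq_of_numLeaves_eq_one (t := t') (by omega)]
    · rw [eq_of_numLeaves_eq_two ht2, eq_of_numLeaves_eq_two (t := t') (by omega)]
  by_cases hl : l.numLeaves = l'.numLeaves
  · obtain rfl := hsmall (by omega) hl
    obtain rfl := hsmall (t := r) (t' := r') (by omega) (by omega)
    exact ⟨MulEquiv.refl _⟩
  · obtain rfl := hsmall (t := l) (t' := r') (by omega) (by omega)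
    obtain rfl := hsmall (t := r) (t' := l') (by omega) (by omega)
    exact nonempty_equiv_joined_swap _ _

/-! ### Hurwitz moves and the monodromy group -/

theorem HurwitzMove.monodromyGroup_eq {G : Type*} [Group G] {r : ℕ} {m m' : Factorization G r}
    (h : HurwitzMove m m') : monodromyGroup m = monodromyGroup m' := by
  obtain ⟨i, j, -, hi, hj, hl⟩ := h
  have hm : ∀ l, m l ∈ monodromyGroup m := fun l => Subgroup.subset_closure ⟨l, rfl⟩
  have hm' : ∀ l, m' l ∈ monodromyGroup m' := fun l => Subgroup.subset_closure ⟨l, rfl⟩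
  apply le_antisymm
  · refine (Subgroup.closure_le _).2 ?_
    rintro _ ⟨l, rfl⟩
    have h1 : m i ∈ monodromyGroup m' := hj ▸ hm' j
    by_cases hli : l = i
    · exact hli ▸ h1
    by_cases hlj : l = j
    · have h2 : m j = m i * m' i * (m i)⁻¹ := by
        rw [hi]
        group
      rw [hlj, h2]
      exact mul_mem (mul_mem h1 (hm' i)) (inv_mem h1)
    · rw [← hl l hli hlj]
      exact hm' l
  · refine (Subgroup.closure_le _).2 ?_
    rintro _ ⟨l, rfl⟩
    by_cases hli : l = i
    · rw [hli, hi]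
      exact mul_mem (mul_mem (inv_mem (hm i)) (hm j)) (hm i)
    by_cases hlj : l = j
    · rw [hlj, hj]
      exact hm i
    · rw [hl l hli hlj]
      exact hm l

theorem StronglyEquivalent.monodromyGroup_eq {G : Type*} [Group G] {r : ℕ}
    {m m' : Factorization G r} (h : StronglyEquivalent m m') :
    monodromyGroup m = monodromyGroup m' := by
  induction h with
  | rel _ _ h => exact h.monodromyGroup_eq
  | refl => rfl
  | symm _ _ _ ih => exact ih.symm
  | trans _ _ _ _ _ ih ih' => exact ih.trans ih'

theorem monodromyGroup_conjFactorization {G : Type*} [Group G] {r : ℕ} (g : G)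
    (m : Factorization G r) : monodromyGroup (conjFactorization g m) =
      (monodromyGroup m).map (MulAut.conj g).toMonoidHom := by
  rw [monodromyGroup, monodromyGroup, MonoidHom.map_closure, range_conjFactorization]
  rfl

/-! ### The factorizations of the theorem -/

theorem simpleLift_toPSL {A : SL(2, ℤ)} (hA : IsConj (matX * matY) A) :
    simpleLift (toPSL A) = A := by
  have h : IsConj (toPSL (matX * matY)) (toPSL A) := toPSL.map_isConj hA
  exact (existsUnique_simpleLift h).unique (simpleLift_spec h) ⟨hA, rfl⟩

/-- Conjugating by an element that commutes with `𝕏𝕐` keeps the monodromy at infinity, a power of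
`𝕏𝕐`. It also keeps the standard form and the fundamental group up to isomorphism, but it may change
the monodromy group. -/
theorem exists_factorization (l r : BinaryTree Unit) (c : B3)
    (hc : Commute (braidToPSL c) (toPSL (matX * matY))) {k N : ℕ}
    (hN : l.numLeaves + r.numLeaves = N) (hk : N = k + 2) :
    ∃ m : Factorization PSL(2, ℤ) N, IsSimple m ∧
      monodromyAtInfinity m = toPSL (matX * matY) ^ (-5 * (k : ℤ) - 4) ∧
      HasStandardForm (fun i => simpleLift (m i)) k ∧
      Nonempty (SimpleFundamentalGroup m ≃* SimpleFundamentalGroup (joined projX projY l r)) ∧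
      monodromyGroup m = (joinedGroup l r).map (MulAut.conj (braidToPSL c)).toMonoidHom := by
  subst hN
  have hlift : ∀ i, toPSL (conjFactorization (braidToSL c) (joined matX matY l r) i) =
      conjFactorization (braidToPSL c) (joined projX projY l r) i := by
    have h := map_conjFactorization toPSL (braidToSL c) (joined matX matY l r)
    rw [map_joined] at h
    exact congrFun h
  have hconj : ∀ i, IsConj (matX * matY)
      (conjFactorization (braidToSL c) (joined matX matY l r) i) := fun i =>
    (isConj_joined _ _ _ _ i).trans (isConj_iff.2 ⟨_, rfl⟩)
  refine ⟨conjFactorization (braidToPSL c) (joined projX projY l r), fun i => ?_, ?_, ?_,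
    nonempty_equiv_conjFactorization _ _, monodromyGroup_conjFactorization _ _⟩
  · rw [← hlift]
    exact toPSL.map_isConj (hconj i)
  · rw [monodromyAtInfinity_conj, monodromyAtInfinity_joined projX_pow projY_pow]
    change braidToPSL c * (toPSL matX * toPSL matY) ^ _ * _ = _
    rw [← map_mul, (hc.zpow_right _).eq, mul_inv_cancel_right, hk]
    congr 1
    push_cast
    ring
  · have h : (fun i => simpleLift (conjFactorization (braidToPSL c) (joined projX projY l r) i)) =
        conjFactorization (braidToSL c) (joined matX matY l r) := by
      funext i
      rw [← hlift, simpleLift_toPSL (hconj i)]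
    rw [h]
    exact (hasStandardForm_joined l r hk).conj _

/-- Write `5k + 4 = (4k + 2) + (k + 2)` and use the recurrence `(k + 2) * catalan (k + 1) = (4k + 2)
* catalan k`: sides of edges and loops of the outer face are counted separately. -/
theorem Ttilde_eq (k : ℕ) : Ttilde k = catalan (k + 1) + catalan k := by
  have h1 := succ_mul_catalan_eq_centralBinom k
  have h2 := succ_mul_catalan_eq_centralBinom (k + 1)
  have h3 := Nat.succ_mul_centralBinom_succ k
  rw [← h1, ← h2] at h3
  have h4 : (k + 2) * catalan (k + 1) = 2 * (2 * k + 1) * catalan k := by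
    refine Nat.eq_of_mul_eq_mul_left (Nat.succ_pos k) ?_
    simp only [Nat.succ_eq_add_one] at h3 ⊢
    linarith
  refine Nat.eq_of_mul_eq_mul_left (Nat.succ_pos (k + 1)) ?_
  have h5 := Ttilde_mul k
  simp only [Nat.succ_eq_add_one] at h5 ⊢
  linarith

/-- The index set of the theorem: the trees with `k + 1` nodes, split at the root, and the trees
with `k` nodes, joined to a leaf. -/
abbrev TreeIndex (k : ℕ) : Type := treesOfNumNodesEq (k + 1) ⊕ treesOfNumNodesEq k

theorem card_treeIndex (k : ℕ) : Fintype.card (TreeIndex k) = Ttilde k := by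
  rw [Fintype.card_sum, Fintype.card_coe, Fintype.card_coe, treesOfNumNodesEq_card_eq_catalan,
    treesOfNumNodesEq_card_eq_catalan, Ttilde_eq]

/-! ### Pointed trees and their distinct monodromy groups -/

namespace TreeIndex

variable {k : ℕ}

/-- The first branch. -/
def left : TreeIndex k → BinaryTree Unit := Sum.elim (fun t => t.1.left) fun _ => nil

/-- The second branch. -/
def right : TreeIndex k → BinaryTree Unit := Sum.elim (fun t => t.1.right) fun t => t.1

/-- The braid that moves the base point. -/
def shift : TreeIndex k → B3 := Sum.elim (fun _ => 1) fun _ => (sigma 0)⁻¹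

theorem numNodes_inl (t : treesOfNumNodesEq (k + 1)) : t.1.numNodes = k + 1 :=
  mem_treesOfNumNodesEq.1 t.2

theorem left_node_right (t : treesOfNumNodesEq (k + 1)) : node () t.1.left t.1.right = t.1 :=
  left_node_right_eq_self fun h => by
    have := numNodes_inl t
    rw [h] at this
    simp at this

theorem numLeaves_add (i : TreeIndex k) : (left i).numLeaves + (right i).numLeaves = k + 2 := by
  rcases i with t | t
  · have h := numNodes_inl t
    rw [← left_node_right t] at h
    simp only [left, right, Sum.elim_inl, numLeaves_eq_numNodes_succ, numNodes] at h ⊢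
    omega
  · have h := mem_treesOfNumNodesEq.1 t.2
    simp only [left, right, Sum.elim_inr, numLeaves_eq_numNodes_succ, numNodes]
    omega

theorem commute_shift (i : TreeIndex k) :
    Commute (braidToPSL (shift i)) (toPSL (matX * matY)) := by
  rcases i with t | t
  · change Commute (braidToPSL 1) _
    rw [map_one]
    exact Commute.one_left _
  · change Commute (braidToPSL (sigma 0)⁻¹) (toPSL (matX * matY))
    rw [map_inv, braidToPSL_sigma_zero, map_mul]
    exact (Commute.refl _).inv_left

/-- The monodromy group of the factorization with index `i`. -/
def group (i : TreeIndex k) : Subgroup PSL(2, ℤ) :=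
  (joinedGroup (left i) (right i)).map (MulAut.conj (braidToPSL (shift i))).toMonoidHom

theorem group_inl (t : treesOfNumNodesEq (k + 1)) :
    group (Sum.inl t : TreeIndex k) = joinedGroup t.1.left t.1.right := by
  change (joinedGroup t.1.left t.1.right).map (MulAut.conj (braidToPSL 1)).toMonoidHom = _
  rw [map_one, map_one]
  exact Subgroup.map_id _

/-- The left branch is read from the base point and the right one from its image under `𝕐`. -/
theorem joinedGroup_injective {l r l' r' : BinaryTree Unit}
    (h : joinedGroup l r = joinedGroup l' r') : l = l' ∧ r = r' := by
  obtain ⟨-, hl, hr, -⟩ := joinedGroup_properties l r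
  obtain ⟨-, hl', hr', -⟩ := joinedGroup_properties l' r'
  rw [h] at hl hr
  exact ⟨hl.unique hl', hr.unique hr'⟩

/-- After the shift by `(𝕏𝕐)⁻¹` the base point lies on the loop of the leaf, and the inverse of the
entry of that leaf becomes `𝕏⁻¹𝕐`. No group of the first kind contains this element. -/
theorem mem_group_inr (t : treesOfNumNodesEq k) :
    projX⁻¹ * projY ∈ group (Sum.inr t : TreeIndex k) := by
  have h : projX * (projX * projY) * projX⁻¹ ∈ joinedGroup nil t.1 :=
    branch_mem_joinedGroup_left nil t.1 ⟨0, by simp⟩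
  refine ⟨_, inv_mem h, ?_⟩
  change MulAut.conj (braidToPSL (sigma 0)⁻¹) _ = _
  rw [map_inv braidToPSL, braidToPSL_sigma_zero, MulAut.conj_apply]
  have e : projX * projX * projX = 1 := by rw [← projX_pow, pow_succ, pow_two]
  calc _ = projY⁻¹ * (projY⁻¹ * (projX * projX * projX)⁻¹ * projX) * (projX * projY) := by group
    _ = projY⁻¹ * projY⁻¹ * (projX * projX) * projY := by
      rw [e]
      group
    _ = projX⁻¹ * projY := by
      rw [projY_inv, ← pow_two projY, projY_pow, one_mul, projX_mul_self]

theorem group_injective : Function.Injective (group : TreeIndex k → Subgroup PSL(2, ℤ)) := by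
  have hne : ∀ (t : treesOfNumNodesEq (k + 1)) (t' : treesOfNumNodesEq k),
      group (Sum.inl t : TreeIndex k) ≠ group (Sum.inr t') := fun t t' h => by
    have h1 := mem_group_inr t'
    rw [← h, group_inl] at h1
    exact (joinedGroup_properties _ _).2.2.2 h1
  rintro (t | t) (t' | t') h
  · rw [group_inl, group_inl] at h
    obtain ⟨h1, h2⟩ := joinedGroup_injective h
    congr 1
    ext1
    rw [← left_node_right t, ← left_node_right t', h1, h2]
  · exact absurd h (hne t t')
  · exact absurd h.symm (hne t' t)
  · have h' : joinedGroup nil t.1 = joinedGroup nil t'.1 :=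
      Subgroup.map_injective (MulAut.conj (braidToPSL (sigma 0)⁻¹)).injective h
    congr 1
    ext1
    exact (joinedGroup_injective h').2

theorem index_group (i : TreeIndex k) : (group i).index = 6 * (k + 1) := by
  have h1 : (group i).index = (joinedGroup (left i) (right i)).index :=
    Subgroup.index_map_equiv _ (MulAut.conj (braidToPSL (shift i)))
  have h2 := (joinedGroup_properties (left i) (right i)).1
  rw [numLeaves_add] at h2
  omega

end TreeIndex

end BraidMonodromy

open BraidMonodromy
theorem theorem1p3 (k : ℕ) :
    ∃ m : Fin (Ttilde k) → Factorization PSL(2, ℤ) (k + 2),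
      (∀ i, IsSimple (m i)) ∧
      (∀ i, monodromyAtInfinity (m i) = toPSL (matX * matY) ^ (-5 * (k : ℤ) - 4)) ∧
      (∀ i j, SameTranscendentalLattice
        (fun l => simpleLift (m i l)) (fun l => simpleLift (m j l))) ∧
      (∀ i j, Nonempty (SimpleFundamentalGroup (m i) ≃* SimpleFundamentalGroup (m j))) ∧
      (2 ≤ k → ∀ i, Nonempty (SimpleFundamentalGroup (m i) ≃* Multiplicative ℤ)) ∧
      (∀ i j, i ≠ j → ¬ StronglyEquivalent (m i) (m j)) ∧
      (∀ i j, i ≠ j → monodromyGroup (m i) ≠ monodromyGroup (m j)) ∧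
      (∀ i, (monodromyGroup (m i)).index = 6 * (k + 1)) := by
  choose m hsimple hinf hform hpi hgroup using fun i : TreeIndex k =>
    exists_factorization i.left i.right i.shift i.commute_shift i.numLeaves_add rfl
  let e : Fin (Ttilde k) ≃ TreeIndex k := (Fintype.equivFinOfCardEq (card_treeIndex k)).symm
  have hne : ∀ i j, i ≠ j → monodromyGroup (m (e i)) ≠ monodromyGroup (m (e j)) := by
    intro i j hij h
    rw [hgroup, hgroup] at h
    exact hij (e.injective (TreeIndex.group_injective h))
  refine ⟨fun i => m (e i), fun i => hsimple _, fun i => hinf _,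
    fun i j => (hform _).sameTranscendentalLattice (hform _), fun i j => ?_, fun hk i => ?_,
    fun i j hij h => hne i j hij h.monodromyGroup_eq, hne, fun i => ?_⟩
  · obtain ⟨f⟩ := hpi (e i)
    obtain ⟨f'⟩ := hpi (e j)
    obtain ⟨f''⟩ := nonempty_equiv_joined
      ((e i).numLeaves_add.trans (e j).numLeaves_add.symm)
    exact ⟨(f.trans f'').trans f'.symm⟩
  · obtain ⟨f⟩ := hpi (e i)
    obtain ⟨f'⟩ := nonempty_equiv_int_joined (l := (e i).left) (r := (e i).right) (by
      rw [TreeIndex.numLeaves_add]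
      omega)
    exact ⟨f.trans f'⟩
  · rw [hgroup]
    exact TreeIndex.index_group _
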